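/- Let $q$ be an even prime power, let $\alpha$ be a collineation of order $3$ of $\mathrm{PG}(2,q^6)$ that fixes pointwise a subplane isomorphic to $\mathrm{PG}(2,q^2)$, and let $\rho$ be a unitary polarity of $\mathrm{PG}(2,q^6)$ (a polarity with exactly $q^9+1$ absolute points) that commutes with $\alpha$. Let $\mathcal{O}_3$ be the set of points $x$ such that $x, x^\alpha, x^{\alpha^2}$ are distinct and not collinear, and let $\mathcal{L}_3$ be the set of lines $\ell$ such that $\ell,\ell^\alpha,\ell^{\alpha^2}$ are distinct and not concurrent. For $x\in\mathcal{O}_3$ let $x^\mu$ be the line $x^\alpha x^{\alpha^2}$, and for $\ell\in\mathcal{L}_3$ let $\ell^\mu$ be the point $\ell^\alpha\cap\ell^{\alpha^2}$. The Figueroa plane $\mathcal{F}$ has the points of $\mathrm{PG}(2,q^6)$ as its points, and one line $\ell_{\mathcal F}$ for every line $\ell$ of $\mathrm{PG}(2,q^6)$: if $\ell\notin\mathcal{L}_3$, then $\ell_{\mathcal F}=\ell$ as a set of points; if $\ell\in\mathcal{L}_3$, then $\ell_{\mathcal F}$ consists of the points of $\ell$ outside $\mathcal{O}_3$ and of the points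 $x\in\mathcal{O}_3$ with $\ell^\mu\in x^\mu$. Let $\rho_{\mathcal F}$ be the polarity of $\mathcal{F}$ that interchanges $x$ and $(x^\rho)_{\mathcal F}$ for every point $x$. The polarity graph $\mathcal{G}(\mathcal{F},\rho_{\mathcal F})$ has the points of $\mathcal{F}$ as vertices, where $x$ and $y$ are adjacent if $x\in y^{\rho_{\mathcal F}}$; a vertex $x$ is absolute if $x\in x^{\rho_{\mathcal F}}$. Then there exists a set of exactly $$\frac{q^{12}-q^4(q^4-1)(q^2+1)}{2}$$ non-absolute vertices of $\mathcal{G}(\mathcal{F},\rho_{\mathcal F})$ that induces a triangle-free subgraph. -/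

import Mathlib

open scoped LinearAlgebra.Projectivization

namespace FigueroaPlane

open Configuration

/-- The collineations of an incidence structure: pairs of a permutation of the points and a
permutation of the lines which preserve incidence in both directions. -/
def collineationGroup (P L : Type*) [Membership P L] :
    Subgroup (Equiv.Perm P × Equiv.Perm L) where
  carrier := {g | ∀ (p : P) (l : L), g.1 p ∈ g.2 l ↔ p ∈ l}
  mul_mem' := by
    intro a b ha hb p l
    exact (ha (b.1 p) (b.2 l)).trans (hb p l)
  one_mem' := fun _ _ => Iff.rfl
  inv_mem' := by
    intro a ha p l
    have h := ha (a.1⁻¹ p) (a.2⁻¹ l)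
    simpa using h.symm

/-- A collineation of an incidence structure. -/
abbrev Collineation (P L : Type*) [Membership P L] : Type _ := ↥(collineationGroup P L)

/-- A polarity: an involutory bijection interchanging points and lines and preserving incidence.
It sends a point `p` to the line `polar p`; as it is involutory, it sends a line `l` to the
point `polar.symm l`. -/
structure Polarity (P L : Type*) [Membership P L] where
  /-- the map from points to lines -/
  polar : P ≃ L
  /-- incidence is preserved -/
  mem_iff : ∀ (p : P) (l : L), polar.symm l ∈ polar p ↔ p ∈ l

section Basic

variable {P L : Type*} [Membership P L]

/-- The action of a collineation on points. -/
def Collineation.pt (α : Collineation P L) : Equiv.Perm P := α.1.1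

/-- The action of a collineation on lines. -/
def Collineation.ln (α : Collineation P L) : Equiv.Perm L := α.1.2

/-- A point is absolute if it lies on its polar line. -/
def Polarity.IsAbsolute (ρ : Polarity P L) (p : P) : Prop := p ∈ ρ.polar p

theorem Polarity.mem_polar_comm (ρ : Polarity P L) (p r : P) :
    p ∈ ρ.polar r ↔ r ∈ ρ.polar p := by
  have h := ρ.mem_iff r (ρ.polar p)
  rwa [Equiv.symm_apply_apply] at h

/-- The polarity graph: two distinct points are adjacent if one is on the polar line of the other.
(Loops, which correspond exactly to the absolute points, are recorded by `IsAbsolute`.) -/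
def Polarity.graph (ρ : Polarity P L) : SimpleGraph P where
  Adj x y := x ≠ y ∧ x ∈ ρ.polar y
  symm := ⟨fun x y h => ⟨h.1.symm, (ρ.mem_polar_comm x y).1 h.2⟩⟩
  loopless := ⟨fun _ h => h.1 rfl⟩

/-- A polarity and a collineation commute (as maps on points, hence also as maps on lines). -/
def Polarity.CommutesWith (ρ : Polarity P L) (α : Collineation P L) : Prop :=
  ∀ p : P, ρ.polar (α.pt p) = α.ln (ρ.polar p)

/-- `α` fixes pointwise a subplane isomorphic to the plane with points `P₀` and lines `L₀`.
The subplane consists of the points in the range of `f` and the lines in the range of `g`. -/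
def Collineation.FixesSubplane (α : Collineation P L) (P₀ L₀ : Type*) [Membership P₀ L₀] : Prop :=
  ∃ (f : P₀ ↪ P) (g : L₀ ↪ L), (∀ p l, f p ∈ g l ↔ p ∈ l) ∧ ∀ p, α.pt (f p) = f p

/-- Points of type three: `x`, `x^α`, `x^(α²)` are distinct and not on a common line. -/
def Collineation.pointsO3 (α : Collineation P L) : Set P :=
  {x | x ≠ α.pt x ∧ α.pt x ≠ α.pt (α.pt x) ∧ x ≠ α.pt (α.pt x) ∧
    ¬ ∃ l : L, x ∈ l ∧ α.pt x ∈ l ∧ α.pt (α.pt x) ∈ l}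

/-- Lines of type three: `l`, `l^α`, `l^(α²)` are distinct and not through a common point. -/
def Collineation.linesL3 (α : Collineation P L) : Set L :=
  {l | l ≠ α.ln l ∧ α.ln l ≠ α.ln (α.ln l) ∧ l ≠ α.ln (α.ln l) ∧
    ¬ ∃ x : P, x ∈ l ∧ x ∈ α.ln l ∧ x ∈ α.ln (α.ln l)}

section Commuting

variable {ρ : Polarity P L} {α : Collineation P L}

theorem Polarity.CommutesWith.symm_ln (h : ρ.CommutesWith α) (l : L) :
    ρ.polar.symm (α.ln l) = α.pt (ρ.polar.symm l) := by
  rw [Equiv.symm_apply_eq, h, Equiv.apply_symm_apply]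

theorem Polarity.CommutesWith.polar_mem_linesL3 (h : ρ.CommutesWith α) (p : P) :
    ρ.polar p ∈ α.linesL3 ↔ p ∈ α.pointsO3 := by
  have key : (∃ x : P, x ∈ ρ.polar p ∧ x ∈ ρ.polar (α.pt p) ∧ x ∈ ρ.polar (α.pt (α.pt p))) ↔
      ∃ l : L, p ∈ l ∧ α.pt p ∈ l ∧ α.pt (α.pt p) ∈ l := by
    constructor
    · rintro ⟨x, h1, h2, h3⟩
      refine ⟨ρ.polar x, ?_⟩
      simpa only [ρ.mem_polar_comm x] using And.intro h1 (And.intro h2 h3)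
    · rintro ⟨l, h1, h2, h3⟩
      exact ⟨ρ.polar.symm l, (ρ.mem_iff _ _).2 h1, (ρ.mem_iff _ _).2 h2, (ρ.mem_iff _ _).2 h3⟩
  simp only [Collineation.linesL3, Collineation.pointsO3, Set.mem_ofPred_eq, ← h _, key, ne_eq,
    EmbeddingLike.apply_eq_iff_eq]

theorem Polarity.CommutesWith.symm_mem_pointsO3 (h : ρ.CommutesWith α) (l : L) :
    ρ.polar.symm l ∈ α.pointsO3 ↔ l ∈ α.linesL3 := by
  rw [← h.polar_mem_linesL3, Equiv.apply_symm_apply]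

end Commuting

end Basic

section Figueroa

variable {P L : Type*} [Membership P L] [ProjectivePlane P L]

/-- A polarity of a finite projective plane is unitary if the plane has order `s ^ 2` and the
polarity has `s ^ 3 + 1` absolute points, for some `s`. -/
def Polarity.IsUnitary (ρ : Polarity P L) : Prop :=
  ∃ s : ℕ, ProjectivePlane.order P L = s ^ 2 ∧ {p | ρ.IsAbsolute p}.ncard = s ^ 3 + 1

/-- The line `x^μ` joining `x^α` and `x^(α²)`, for `x` of type three. -/
noncomputable def Collineation.muLine (α : Collineation P L) (x : P) (hx : x ∈ α.pointsO3) : L :=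
  HasLines.mkLine (L := L) hx.2.1

/-- The point `l^μ` in which `l^α` and `l^(α²)` meet, for `l` of type three. -/
noncomputable def Collineation.muPoint (α : Collineation P L) (l : L) (hl : l ∈ α.linesL3) : P :=
  HasPoints.mkPoint (P := P) hl.2.1

/-- The point set of the Figueroa line corresponding to `l`. If `l` is not of type three, this is
the point set of `l`. If `l` is of type three, the points of `l` that are of type three are
replaced by the points `p` of type three such that `l^μ` is on `p^μ`. -/
def Collineation.figueroaLine (α : Collineation P L) (l : L) : Set P :=
  {p | (p ∈ l ∧ ¬ (p ∈ α.pointsO3 ∧ l ∈ α.linesL3)) ∨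
    ∃ (hp : p ∈ α.pointsO3) (hl : l ∈ α.linesL3), α.muPoint l hl ∈ α.muLine p hp}

/-- The lines of the Figueroa plane of `α`: one line for every line `base` of the original plane.
Its points are those of the original plane. -/
@[ext]
structure FigueroaLine (α : Collineation P L) where
  /-- the line of the original plane -/
  base : L

instance (α : Collineation P L) : Membership P (FigueroaLine α) where
  mem m p := p ∈ α.figueroaLine m.base

theorem mem_figueroaLine_iff (α : Collineation P L) (p : P) (m : FigueroaLine α) :
    p ∈ m ↔ p ∈ α.figueroaLine m.base := Iff.rfl

/-- The lines of the Figueroa plane correspond to the lines of the original plane. -/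
def FigueroaLine.equiv (α : Collineation P L) : L ≃ FigueroaLine α where
  toFun l := ⟨l⟩
  invFun m := m.base
  left_inv _ := rfl
  right_inv _ := rfl

section Commuting

variable {ρ : Polarity P L} {α : Collineation P L}

theorem Polarity.CommutesWith.polar_muPoint (h : ρ.CommutesWith α) (l : L) (hl : l ∈ α.linesL3)
    (hp : ρ.polar.symm l ∈ α.pointsO3) :
    ρ.polar (α.muPoint l hl) = α.muLine (ρ.polar.symm l) hp := by
  have h1 := HasPoints.mkPoint_ax (P := P) hl.2.1
  have h2 := HasLines.mkLine_ax (L := L) hp.2.1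
  have e1 := h.symm_ln l
  have e2 : ρ.polar.symm (α.ln (α.ln l)) = α.pt (α.pt (ρ.polar.symm l)) := by
    rw [h.symm_ln, h.symm_ln]
  have h3 := (ρ.mem_iff _ _).2 h1.1
  have h4 := (ρ.mem_iff _ _).2 h1.2
  rw [e1] at h3
  rw [e2] at h4
  exact (Nondegenerate.eq_or_eq h3 h4 h2.1 h2.2).resolve_left hp.2.1

theorem Polarity.CommutesWith.symm_muLine (h : ρ.CommutesWith α) (p : P) (hp : p ∈ α.pointsO3)
    (hl : ρ.polar p ∈ α.linesL3) :
    ρ.polar.symm (α.muLine p hp) = α.muPoint (ρ.polar p) hl := by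
  rw [Equiv.symm_apply_eq, h.polar_muPoint (ρ.polar p) hl (by simpa using hp)]
  simp

/-- The polarity of the Figueroa plane induced by a polarity `ρ` that commutes with `α`: it
interchanges the point `x` and the Figueroa line corresponding to the line `x^ρ`. -/
def Polarity.figueroa (ρ : Polarity P L) (α : Collineation P L) (h : ρ.CommutesWith α) :
    Polarity P (FigueroaLine α) where
  polar := ρ.polar.trans (FigueroaLine.equiv α)
  mem_iff := by
    rintro p ⟨l⟩
    change (ρ.polar.symm l ∈ α.figueroaLine (ρ.polar p)) ↔ p ∈ α.figueroaLine l
    simp only [Collineation.figueroaLine, Set.mem_ofPred_eq]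
    refine or_congr (and_congr (ρ.mem_iff p l) (not_congr ?_)) ⟨?_, ?_⟩
    · rw [h.symm_mem_pointsO3, h.polar_mem_linesL3, and_comm]
    · rintro ⟨hl, hp, hm⟩
      refine ⟨(h.polar_mem_linesL3 p).1 hp, (h.symm_mem_pointsO3 l).1 hl, ?_⟩
      rwa [← h.symm_muLine, ← h.polar_muPoint, ρ.mem_iff] at hm
    · rintro ⟨hp, hl, hm⟩
      refine ⟨(h.symm_mem_pointsO3 l).2 hl, (h.polar_mem_linesL3 p).2 hp, ?_⟩
      rwa [← h.symm_muLine p hp, ← h.polar_muPoint l hl, ρ.mem_iff]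

end Commuting

end Figueroa

end FigueroaPlane

namespace FigueroaPlane

open Configuration

/-! ### Transfer of triangle-free sets from the Desarguesian plane to the Figueroa plane. -/

section Synthetic

variable {P L : Type*} [Membership P L]

/-! In characteristic 2, coordinates can be chosen in which `α` is a field automorphism `s` of order
3 and `ρ` is given by `herm t`, with `t` of order 2. An affine point (1, x, y) then has norm N = y +
t y + x t(x), which vanishes exactly at absolute points. If three non-absolute affine points are
pairwise conjugate, their inverse norms sum to zero (`sum_inv_herm_eq_zero`). Hence for any additive
φ : K → F₂ with φ(1) = 1, the set T of affine points with φ(1/N) = 1 contains no triangle: three odd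
values cannot sum to zero. Balance of φ and of the trace gives |T| = q¹²/2 (`card_oddPairs`).

Passing to the Figueroa plane uses the permutation x ↦ (x^μ)^ρ of the points of type three, which
turns Figueroa conjugacy into ordinary conjugacy. Conjugacy among points fixed by `α` is unchanged,
and a fixed point is never conjugate to a point of type three. So the fixed points of T, together
with the pullback of its points of type three, again span no triangle
(`Polarity.exists_triangleFree_figueroa`); only the non-fixed points of T with collinear orbit are
lost.

A lost point lies on an affine line defined over F = Fix(s), where |F| = f = q². There are f
vertical lines and f² others. Summed over all of them, at most half of the q⁶ − f points of each
line that are not rational over F can be in T, so the loss is at most (q² + q⁴)(q⁶ − q²)/2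
(`card_collinearPairs_le`). The difference from q¹²/2 is the required number, and a subset has
exactly that size. -/

theorem Collineation.pt_mem_ln_iff (α : Collineation P L) {p : P} {l : L} :
    α.pt p ∈ α.ln l ↔ p ∈ l := α.2 p l

theorem Collineation.not_mem_of_fixed (α : Collineation P L) {p : P} {l : L} (hp : α.pt p = p)
    (hl : l ∈ α.linesL3) : p ∉ l := by
  intro h
  have h1 : p ∈ α.ln l := by rw [← hp]; exact α.pt_mem_ln_iff.2 h
  have h2 : p ∈ α.ln (α.ln l) := by rw [← hp]; exact α.pt_mem_ln_iff.2 h1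
  exact hl.2.2.2 ⟨p, h, h1, h2⟩

theorem Collineation.not_mem_pointsO3_of_fixed (α : Collineation P L) {p : P}
    (hp : α.pt p = p) : p ∉ α.pointsO3 := fun h => h.1 hp.symm

/-- Points that are neither fixed nor of type three have a collinear orbit. -/
theorem Collineation.exists_line_of_not_mem_pointsO3 (α : Collineation P L)
    (h3 : ∀ x, α.pt (α.pt (α.pt x)) = x)
    {x : P} (hx : α.pt x ≠ x) (hx3 : x ∉ α.pointsO3) :
    ∃ l : L, x ∈ l ∧ α.pt x ∈ l ∧ α.pt (α.pt x) ∈ l := by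
  by_contra h
  refine hx3 ⟨hx.symm, fun h' => hx (α.pt.injective h').symm, fun h' => hx ?_, h⟩
  conv_lhs => rw [h']
  exact h3 x

variable [ProjectivePlane P L] {α : Collineation P L} {ρ : Polarity P L}

theorem Collineation.pt_mem_muLine {x : P} (hx : x ∈ α.pointsO3) :
    α.pt x ∈ α.muLine x hx ∧ α.pt (α.pt x) ∈ α.muLine x hx :=
  HasLines.mkLine_ax (L := L) hx.2.1

theorem Collineation.not_mem_muLine {x : P} (hx : x ∈ α.pointsO3) : x ∉ α.muLine x hx :=
  fun h => hx.2.2.2 ⟨_, h, (α.pt_mem_muLine hx).1, (α.pt_mem_muLine hx).2⟩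

/-- The three lines `x^μ`, `x^(μα)`, `x^(μα²)` form a triangle with vertices `x`, `x^α`, `x^(α²)`. -/
theorem Collineation.mem_ln_muLine (h3 : ∀ x, α.pt (α.pt (α.pt x)) = x) {x : P}
    (hx : x ∈ α.pointsO3) :
    x ∈ α.ln (α.muLine x hx) ∧ x ∈ α.ln (α.ln (α.muLine x hx)) ∧
      α.ln (α.muLine x hx) ≠ α.ln (α.ln (α.muLine x hx)) := by
  have h1 := (α.pt_mem_muLine hx).1
  have h2 := (α.pt_mem_muLine hx).2
  have e1 : x ∈ α.ln (α.muLine x hx) := by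
    have := α.pt_mem_ln_iff.2 h2
    rwa [h3] at this
  have e2 : x ∈ α.ln (α.ln (α.muLine x hx)) := by
    have := α.pt_mem_ln_iff.2 (α.pt_mem_ln_iff.2 h1)
    rwa [h3] at this
  refine ⟨e1, e2, fun h => ?_⟩
  have h' : α.muLine x hx = α.ln (α.muLine x hx) := α.ln.injective h
  rw [← h'] at e1
  exact α.not_mem_muLine hx e1

/-- The orbit of x^μ consists of the sides of the triangle on the orbit of x, and these are not
concurrent. -/
theorem Collineation.muLine_mem_linesL3 (h3 : ∀ x, α.pt (α.pt (α.pt x)) = x) {x : P}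
    (hx : x ∈ α.pointsO3) : α.muLine x hx ∈ α.linesL3 := by
  obtain ⟨e1, e2, e3⟩ := α.mem_ln_muLine h3 hx
  have h0 := α.not_mem_muLine hx
  refine ⟨fun h => h0 (h ▸ e1), e3, fun h => h0 (h ▸ e2), ?_⟩
  rintro ⟨y, y0, y1, y2⟩
  have := (Nondegenerate.eq_or_eq e1 y1 e2 y2).resolve_right e3
  exact h0 (this ▸ y0)

/-- The point x is recovered as the intersection of the two other images of x^μ under `α`. -/
theorem Collineation.muLine_injective (h3 : ∀ x, α.pt (α.pt (α.pt x)) = x) {x y : P}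
    (hx : x ∈ α.pointsO3) (hy : y ∈ α.pointsO3) (h : α.muLine x hx = α.muLine y hy) : x = y := by
  obtain ⟨e1, e2, e3⟩ := α.mem_ln_muLine h3 hx
  obtain ⟨f1, f2, -⟩ := α.mem_ln_muLine h3 hy
  rw [← h] at f1 f2
  exact (Nondegenerate.eq_or_eq e1 f1 e2 f2).resolve_right e3

theorem Polarity.figueroa_mem_polar_iff (hcomm : ρ.CommutesWith α) {x y : P} :
    y ∈ (ρ.figueroa α hcomm).polar x ↔ y ∈ α.figueroaLine (ρ.polar x) := Iff.rfl

theorem Polarity.figueroa_mem_polar_of_not_mem (hcomm : ρ.CommutesWith α) {x y : P}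
    (hy : y ∉ α.pointsO3) : y ∈ (ρ.figueroa α hcomm).polar x ↔ y ∈ ρ.polar x := by
  rw [ρ.figueroa_mem_polar_iff]
  simp [Collineation.figueroaLine, hy]

/-- Since ρ commutes with `α`, it intertwines the two maps μ: for l = x^ρ the point l^μ is (x^μ)^ρ.
-/
theorem Polarity.figueroa_mem_polar_of_mem (hcomm : ρ.CommutesWith α) {x y : P}
    (hx : x ∈ α.pointsO3) (hy : y ∈ α.pointsO3) :
    y ∈ (ρ.figueroa α hcomm).polar x ↔
      ρ.polar.symm (α.muLine x hx) ∈ ρ.polar (ρ.polar.symm (α.muLine y hy)) := by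
  have hl := (hcomm.polar_mem_linesL3 x).2 hx
  rw [ρ.figueroa_mem_polar_iff, hcomm.symm_muLine x hx hl, Equiv.apply_symm_apply]
  simp [Collineation.figueroaLine, hy, hl]

/-- A fixed point on a line lies on all its images, so no line of type three contains one. -/
theorem Polarity.figueroa_not_mem_polar (hcomm : ρ.CommutesWith α) {x y : P}
    (hx : x ∈ α.pointsO3) (hy : α.pt y = y) : y ∉ (ρ.figueroa α hcomm).polar x := by
  rw [ρ.figueroa_mem_polar_of_not_mem hcomm (α.not_mem_pointsO3_of_fixed hy)]
  exact α.not_mem_of_fixed hy ((hcomm.polar_mem_linesL3 x).2 hx)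

/-- A set of non-absolute points without three pairwise conjugate points yields a set of
non-absolute points of the Figueroa plane that induces a triangle-free graph, after its points
that are neither fixed nor of type three are discarded. -/
theorem Polarity.exists_triangleFree_figueroa [Finite P] (hcomm : ρ.CommutesWith α)
    (h3 : ∀ x, α.pt (α.pt (α.pt x)) = x) (T : Set P) (hT : ∀ x ∈ T, x ∉ ρ.polar x)
    (hT3 : ∀ x ∈ T, ∀ y ∈ T, ∀ z ∈ T, x ∈ ρ.polar y → y ∈ ρ.polar z → x ∈ ρ.polar z → False) :
    ∃ S : Set P, (∀ x ∈ S, ¬ (ρ.figueroa α hcomm).IsAbsolute x) ∧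
      ((ρ.figueroa α hcomm).graph.induce S).CliqueFree 3 ∧
      S.ncard = {x ∈ T | α.pt x = x}.ncard + {x ∈ T | x ∈ α.pointsO3}.ncard := by
  classical
  -- The map x ↦ (x^μ)^ρ; it is injective on a finite set, hence a permutation of the points of type
  -- three.
  let s : α.pointsO3 → α.pointsO3 := fun x =>
    ⟨ρ.polar.symm (α.muLine x.1 x.2),
      (hcomm.symm_mem_pointsO3 _).2 (α.muLine_mem_linesL3 h3 x.2)⟩
  have hs : Function.Injective s := by
    intro x y h
    have h' : ρ.polar.symm (α.muLine x.1 x.2) = ρ.polar.symm (α.muLine y.1 y.2) :=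
      congrArg Subtype.val h
    exact Subtype.ext (α.muLine_injective h3 x.2 y.2 (ρ.polar.symm.injective h'))
  let e : α.pointsO3 ≃ α.pointsO3 := Equiv.ofBijective s (Finite.injective_iff_bijective.1 hs)
  -- No edge joins `A` to `B`. A triangle therefore lies in `A`, where conjugacy is the old one, or
  -- in `B`, where `s` carries it to a triangle of T.
  let A : Set P := {x ∈ T | α.pt x = x}
  let B : Set P := Subtype.val '' {x : α.pointsO3 | (s x).1 ∈ T}
  have hB : B.ncard = {x ∈ T | x ∈ α.pointsO3}.ncard := by
    have e1 : {x ∈ T | x ∈ α.pointsO3} =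
        Subtype.val '' (e '' {x : α.pointsO3 | (s x).1 ∈ T}) := by
      ext x
      constructor
      · rintro ⟨h1, h2⟩
        refine ⟨⟨x, h2⟩, ⟨e.symm ⟨x, h2⟩, ?_, e.apply_symm_apply _⟩, rfl⟩
        have : s (e.symm ⟨x, h2⟩) = ⟨x, h2⟩ := e.apply_symm_apply _
        simpa [this] using h1
      · rintro ⟨_, ⟨y, hy, rfl⟩, rfl⟩
        exact ⟨hy, (s y).2⟩
    rw [e1, Set.ncard_image_of_injective _ Subtype.val_injective,
      Set.ncard_image_of_injective _ Subtype.val_injective,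
      Set.ncard_image_of_injective _ e.injective]
  have hA3 : ∀ x ∈ A, x ∉ α.pointsO3 := fun x hx => α.not_mem_pointsO3_of_fixed hx.2
  have hdisj : Disjoint A B := by
    rw [Set.disjoint_left]
    rintro x hx ⟨y, -, rfl⟩
    exact hA3 _ hx y.2
  have hBB : ∀ x (hx : x ∈ α.pointsO3) y (hy : y ∈ α.pointsO3),
      x ∈ (ρ.figueroa α hcomm).polar y ↔ (s ⟨x, hx⟩).1 ∈ ρ.polar (s ⟨y, hy⟩).1 := by
    intro x hx y hy
    rw [ρ.figueroa_mem_polar_of_mem hcomm hy hx, ρ.mem_polar_comm]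
  have hAA : ∀ x ∈ A, ∀ y, x ∈ (ρ.figueroa α hcomm).polar y ↔ x ∈ ρ.polar y :=
    fun x hx y => ρ.figueroa_mem_polar_of_not_mem hcomm (hA3 x hx)
  have hAB : ∀ x ∈ A, ∀ y ∈ B, x ∉ (ρ.figueroa α hcomm).polar y := by
    rintro x hx _ ⟨y, -, rfl⟩
    exact ρ.figueroa_not_mem_polar hcomm y.2 hx.2
  have hBA : ∀ x ∈ B, ∀ y ∈ A, x ∉ (ρ.figueroa α hcomm).polar y := by
    intro x hx y hy h
    rw [Polarity.mem_polar_comm] at h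
    exact hAB y hy x hx h
  refine ⟨A ∪ B, ?_, ?_, ?_⟩
  · rintro x (hx | ⟨y, hy, rfl⟩) h
    · exact hT x hx.1 ((hAA x hx x).1 h)
    · exact hT _ hy ((hBB _ y.2 _ y.2).1 h)
  · intro t ht
    obtain ⟨a, b, c, hab, hac, hbc, -⟩ := SimpleGraph.is3Clique_iff.1 ht
    replace hab := hab.2
    replace hac := hac.2
    replace hbc := hbc.2
    obtain ⟨a, ha⟩ := a
    obtain ⟨b, hb⟩ := b
    obtain ⟨c, hc⟩ := c
    simp only [Function.Embedding.subtype_apply] at hab hac hbc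
    rcases ha with ha | ha
    · have hb' := hb.resolve_right fun h => hAB _ ha _ h hab
      have hc' := hc.resolve_right fun h => hAB _ ha _ h hac
      exact hT3 a ha.1 b hb'.1 c hc'.1 ((hAA a ha b).1 hab) ((hAA b hb' c).1 hbc)
        ((hAA a ha c).1 hac)
    · have hb' := hb.resolve_left fun h => hBA _ ha _ h hab
      have hc' := hc.resolve_left fun h => hBA _ ha _ h hac
      obtain ⟨a, ha', rfl⟩ := ha
      obtain ⟨b, hb', rfl⟩ := hb'
      obtain ⟨c, hc', rfl⟩ := hc'
      exact hT3 _ ha' _ hb' _ hc' ((hBB _ a.2 _ b.2).1 hab) ((hBB _ b.2 _ c.2).1 hbc)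
        ((hBB _ a.2 _ c.2).1 hac)
  · rw [Set.ncard_union_eq hdisj, hB]

end Synthetic

open Configuration

/-! ### The fundamental theorem for a collineation fixing the standard frame. -/

section Coordinates

open Matrix Projectivization

variable {K : Type*} [Field K]

/-- The collineation `c` sends the point spanned by `v` to the point spanned by `w`. -/
def Collineation.Sends (c : Collineation (ℙ K (Fin 3 → K)) (ℙ K (Fin 3 → K)))
    (v w : Fin 3 → K) : Prop :=
  ∃ (hv : v ≠ 0) (hw : w ≠ 0), c.pt (mk K v hv) = mk K w hw

theorem mk_mem_mk_iff {v w : Fin 3 → K} (hv : v ≠ 0) (hw : w ≠ 0) :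
    mk K v hv ∈ mk K w hw ↔ v ⬝ᵥ w = 0 := Iff.rfl

theorem mk_smul_eq {v : Fin 3 → K} {a : K} (h : a • v ≠ 0) (hv : v ≠ 0) :
    mk K (a • v) h = mk K v hv := (mk_eq_mk_iff' K _ _ _ _).2 ⟨a, rfl⟩

namespace Collineation

variable {c : Collineation (ℙ K (Fin 3 → K)) (ℙ K (Fin 3 → K))} {x y z x' y' z' v w : Fin 3 → K}

theorem exists_sends (c : Collineation (ℙ K (Fin 3 → K)) (ℙ K (Fin 3 → K))) (hv : v ≠ 0) :
    ∃ w, c.Sends v w :=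
  ⟨(c.pt (mk K v hv)).rep, hv, rep_nonzero _, (mk_rep _).symm⟩

theorem Sends.smul {a b : K} (h : c.Sends v w) (ha : a ≠ 0) (hb : b ≠ 0) :
    c.Sends (a • v) (b • w) := by
  obtain ⟨hv, hw, h⟩ := h
  exact ⟨smul_ne_zero ha hv, smul_ne_zero hb hw, by rw [mk_smul_eq _ hv, mk_smul_eq _ hw, h]⟩

theorem Sends.symm (h : c.Sends v w) : (c⁻¹).Sends w v := by
  obtain ⟨hv, hw, h⟩ := h
  refine ⟨hw, hv, ?_⟩
  rw [← h]
  exact Equiv.symm_apply_apply c.pt _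

/-- Three points are collinear exactly when their determinant vanishes; every later equation for the
coordinate map comes from this test. -/
theorem Sends.det_eq_zero (hx : c.Sends x x') (hy : c.Sends y y') (hz : c.Sends z z')
    (h : det (of ![x, y, z]) = 0) : det (of ![x', y', z']) = 0 := by
  obtain ⟨hx0, hx0', hx⟩ := hx
  obtain ⟨hy0, hy0', hy⟩ := hy
  obtain ⟨hz0, hz0', hz⟩ := hz
  obtain ⟨l, hl, hl'⟩ := exists_mulVec_eq_zero_iff.2 h
  have key : ∀ {u u' : Fin 3 → K} (hu : u ≠ 0) (hu' : u' ≠ 0), c.pt (mk K u hu) = mk K u' hu' →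
      u ⬝ᵥ l = 0 → u' ⬝ᵥ (c.ln (mk K l hl)).rep = 0 := by
    intro u u' hu hu' e h0
    have h1 : mk K u hu ∈ mk K l hl := h0
    rw [← c.pt_mem_ln_iff, e, ← mk_rep (c.ln (mk K l hl))] at h1
    exact h1
  refine exists_mulVec_eq_zero_iff.1 ⟨_, rep_nonzero (c.ln (mk K l hl)), ?_⟩
  ext i
  fin_cases i
  · exact key hx0 hx0' hx (congrFun hl' 0)
  · exact key hy0 hy0' hy (congrFun hl' 1)
  · exact key hz0 hz0' hz (congrFun hl' 2)

theorem Sends.det_ne_zero (hx : c.Sends x x') (hy : c.Sends y y') (hz : c.Sends z z')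
    (h : det (of ![x, y, z]) ≠ 0) : det (of ![x', y', z']) ≠ 0 :=
  fun h' => h (hx.symm.det_eq_zero hy.symm hz.symm h')

/-- The fundamental theorem of projective geometry for planes: a collineation that fixes the
standard frame is induced by an automorphism of the field. -/
theorem exists_ringEquiv_of_fixes_frame [Finite K]
    (h0 : c.Sends ![1, 0, 0] ![1, 0, 0]) (h1 : c.Sends ![0, 1, 0] ![0, 1, 0])
    (h2 : c.Sends ![0, 0, 1] ![0, 0, 1]) (hu : c.Sends ![1, 1, 1] ![1, 1, 1]) :
    ∃ s : K ≃+* K, ∀ v : Fin 3 → K, v ≠ 0 → c.Sends v (s ∘ v) := by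
  have aff : ∀ x y : K, ∃ x' y', c.Sends ![1, x, y] ![1, x', y'] := by
    intro x y
    obtain ⟨w, hw⟩ := c.exists_sends (v := ![1, x, y]) (by simp)
    have := hw.det_ne_zero h1 h2 (by simp [det_fin_three])
    have hw0 : w 0 ≠ 0 := by simpa [det_fin_three] using this
    refine ⟨w 1 / w 0, w 2 / w 0, ?_⟩
    have := hw.smul one_ne_zero (inv_ne_zero hw0)
    convert this using 1
    · simp
    · ext i; fin_cases i <;> simp [hw0] <;> field_simp
  have ax : ∀ x : K, ∃ x', c.Sends ![1, x, 0] ![1, x', 0] := by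
    intro x
    obtain ⟨x', y', h⟩ := aff x 0
    have := h.det_eq_zero h0 h1 (by simp [det_fin_three])
    have : y' = 0 := by simpa [det_fin_three] using this
    exact ⟨x', this ▸ h⟩
  have ay : ∀ y : K, ∃ y', c.Sends ![1, 0, y] ![1, 0, y'] := by
    intro y
    obtain ⟨x', y', h⟩ := aff 0 y
    have := h.det_eq_zero h0 h2 (by simp [det_fin_three])
    have : x' = 0 := by simpa [det_fin_three] using this
    exact ⟨y', this ▸ h⟩
  choose s hs using ax
  choose t ht using ay
  have aff' : ∀ x y : K, c.Sends ![1, x, y] ![1, s x, t y] := by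
    intro x y
    obtain ⟨x', y', h⟩ := aff x y
    have e1 := h.det_eq_zero (hs x) h2 (by simp [det_fin_three])
    have e2 := h.det_eq_zero (ht y) h1 (by simp [det_fin_three])
    simp [det_fin_three] at e1 e2
    have e1' : x' = s x := by linear_combination -e1
    have e2' : y' = t y := by linear_combination e2
    rw [← e1', ← e2']
    exact h
  have hst : ∀ x, t x = s x := by
    intro x
    have e := (aff' x x).det_eq_zero hu h0 (by simp [det_fin_three])
    simp [det_fin_three] at e
    linear_combination -e
  simp only [hst] at aff' ht
  have s0 : s 0 = 0 := by
    have e := (hs 0).det_eq_zero h0 h2 (by simp [det_fin_three])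
    simpa [det_fin_three] using e
  have s1 : s 1 = 1 := by
    have e := (hs 1).det_eq_zero hu h2 (by simp [det_fin_three])
    simp [det_fin_three] at e
    linear_combination -e
  have inf : ∀ m : K, c.Sends ![0, 1, m] ![0, 1, s m] := by
    intro m
    obtain ⟨w, hw⟩ := c.exists_sends (v := ![0, 1, m]) (by simp)
    have e0 := hw.det_eq_zero h1 h2 (by simp [det_fin_three])
    have e1 := hw.det_ne_zero h0 h2 (by simp [det_fin_three])
    have e2 := hw.det_eq_zero h0 (aff' 1 m) (by simp [det_fin_three])
    simp [det_fin_three, s1] at e0 e1 e2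
    have := hw.smul one_ne_zero (inv_ne_zero e1)
    convert this using 1
    · simp
    · have e3 : w 2 = w 1 * s m := by linear_combination e2
      ext i; fin_cases i <;> simp [e0, e1, e3]
  -- The line through the origin with slope m goes to the one with slope s m.
  have hmul : ∀ m x, s (m * x) = s m * s x := by
    intro m x
    have e := (aff' x (m * x)).det_eq_zero h0 (inf m) (by simp [det_fin_three]; ring)
    simp [det_fin_three] at e
    linear_combination e
  -- The line of slope 1 through (0, b) goes to the line of slope 1 through (0, s b).
  have hadd : ∀ x b, s (x + b) = s x + s b := by
    intro x b
    have e := (aff' x (x + b)).det_eq_zero (ht b) (inf 1) (by simp [det_fin_three]; ring)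
    simp [det_fin_three, s1] at e
    linear_combination e
  let f : K →+* K :=
    { toFun := s, map_one' := s1, map_mul' := hmul, map_zero' := s0, map_add' := hadd }
  let g : K ≃+* K := RingEquiv.ofBijective f (Finite.injective_iff_bijective.1 f.injective)
  have hg : ∀ x, g x = s x := fun x => rfl
  refine ⟨g, fun v hv => ?_⟩
  have hg' : ∀ {a}, a ≠ 0 → s a ≠ 0 := fun ha => by rwa [← hg, ne_eq, map_eq_zero]
  have hdiv : ∀ {a b : K}, a ≠ 0 → s a * s (b / a) = s b := by
    intro a b ha
    rw [← hmul, mul_div_cancel₀ _ ha]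
  by_cases v0 : v 0 = 0
  · by_cases v1 : v 1 = 0
    · have v2 : v 2 ≠ 0 := by
        intro v2
        apply hv
        ext i; fin_cases i <;> simp [v0, v1, v2]
      convert h2.smul v2 (hg' v2) using 1
      · ext i; fin_cases i <;> simp [v0, v1]
      · ext i; fin_cases i <;> simp [v0, v1, hg, s0]
    · convert (inf (v 2 / v 1)).smul v1 (hg' v1) using 1
      · ext i; fin_cases i <;> simp [v0]; field_simp
      · ext i; fin_cases i <;> simp [v0, hg, s0, hdiv v1]
  · convert (aff' (v 1 / v 0) (v 2 / v 0)).smul v0 (hg' v0) using 1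
    · ext i; fin_cases i <;> simp <;> field_simp
    · ext i; fin_cases i <;> simp [hg, hdiv v0]

end Collineation

end Coordinates

open Configuration

/-! ### Semilinear coordinates for a collineation and a polarity. -/

section Frames

open Matrix Projectivization

variable {K : Type*} [Field K]

/-- A pair of linear automorphisms preserving the vanishing of the dot product is a collineation. -/
def linearCollineation (g h : (Fin 3 → K) ≃ₗ[K] (Fin 3 → K))
    (H : ∀ x y, g x ⬝ᵥ h y = 0 ↔ x ⬝ᵥ y = 0) :
    Collineation (ℙ K (Fin 3 → K)) (ℙ K (Fin 3 → K)) :=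
  ⟨(MulAction.toPerm g, MulAction.toPerm h), by
    intro p l
    induction p with | h v hv =>
    induction l with | h w hw =>
    exact H v w⟩

theorem linearCollineation_sends {g h : (Fin 3 → K) ≃ₗ[K] (Fin 3 → K)}
    {H : ∀ x y, g x ⬝ᵥ h y = 0 ↔ x ⬝ᵥ y = 0} {v : Fin 3 → K} (hv : v ≠ 0) :
    (linearCollineation g h H).Sends v (g v) :=
  ⟨hv, g.map_ne_zero_iff.2 hv, rfl⟩

/-- Lines are transformed by the inverse transpose, which preserves the dot product. -/
theorem exists_collineation_mulVec {A : Matrix (Fin 3) (Fin 3) K} (hA : A.det ≠ 0) :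
    ∃ c : Collineation (ℙ K (Fin 3 → K)) (ℙ K (Fin 3 → K)),
      ∀ v : Fin 3 → K, v ≠ 0 → c.Sends v (A *ᵥ v) := by
  have hA' : IsUnit A.det := isUnit_iff_ne_zero.2 hA
  have e1 : A * A⁻¹ = 1 := A.mul_nonsing_inv hA'
  have e2 : A⁻¹ * A = 1 := A.nonsing_inv_mul hA'
  have e3 : Aᵀ * A⁻¹ᵀ = 1 := by rw [← transpose_mul, e2, transpose_one]
  have e4 : A⁻¹ᵀ * Aᵀ = 1 := by rw [← transpose_mul, e1, transpose_one]
  refine ⟨linearCollineation (LinearEquiv.ofLinearMap A.mulVecLin A⁻¹.mulVecLin ?_ ?_)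
    (LinearEquiv.ofLinearMap A⁻¹ᵀ.mulVecLin Aᵀ.mulVecLin ?_ ?_) ?_, fun v hv => ?_⟩
  · rw [← mulVecLin_mul, e1, mulVecLin_one]
  · rw [← mulVecLin_mul, e2, mulVecLin_one]
  · rw [← mulVecLin_mul, e4, mulVecLin_one]
  · rw [← mulVecLin_mul, e3, mulVecLin_one]
  · intro x y
    simp only [LinearEquiv.coe_ofLinearMap, mulVecLin_apply]
    rw [dotProduct_mulVec, vecMul_transpose, mulVec_mulVec, e2, one_mulVec]
  · exact linearCollineation_sends hv

namespace Collineation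

variable {c d : Collineation (ℙ K (Fin 3 → K)) (ℙ K (Fin 3 → K))} {u v w : Fin 3 → K}

theorem Sends.trans (h1 : c.Sends u v) (h2 : d.Sends v w) : (d * c).Sends u w := by
  obtain ⟨hu, hv, h1⟩ := h1
  obtain ⟨_, hw, h2⟩ := h2
  exact ⟨hu, hw, (congrArg d.pt h1).trans h2⟩

/-- Conjugating by the linear collineations of A and B reduces to a collineation fixing the standard
frame. -/
theorem exists_semilinear_of_frame [Finite K] {A B : Matrix (Fin 3) (Fin 3) K} (hA : A.det ≠ 0)
    (hB : B.det ≠ 0) (h0 : c.Sends (A *ᵥ ![1, 0, 0]) (B *ᵥ ![1, 0, 0]))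
    (h1 : c.Sends (A *ᵥ ![0, 1, 0]) (B *ᵥ ![0, 1, 0]))
    (h2 : c.Sends (A *ᵥ ![0, 0, 1]) (B *ᵥ ![0, 0, 1]))
    (hu : c.Sends (A *ᵥ ![1, 1, 1]) (B *ᵥ ![1, 1, 1])) :
    ∃ s : K ≃+* K, ∀ v : Fin 3 → K, v ≠ 0 → c.Sends (A *ᵥ v) (B *ᵥ (s ∘ v)) := by
  obtain ⟨a, ha⟩ := exists_collineation_mulVec hA
  obtain ⟨b, hb⟩ := exists_collineation_mulVec hB
  have key : ∀ {x : Fin 3 → K}, x ≠ 0 → c.Sends (A *ᵥ x) (B *ᵥ x) →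
      (b⁻¹ * (c * a)).Sends x x :=
    fun hx h => ((ha _ hx).trans h).trans (hb _ hx).symm
  obtain ⟨s, hs⟩ := exists_ringEquiv_of_fixes_frame (key (by simp) h0) (key (by simp) h1)
    (key (by simp) h2) (key (by simp) hu)
  refine ⟨s, fun v hv => ?_⟩
  have hsv := hs v hv
  have := ((ha v hv).symm.trans hsv).trans (hb _ hsv.choose_spec.choose)
  rwa [show b * (b⁻¹ * (c * a) * a⁻¹) = c by group] at this

end Collineation

/-- Four vectors, no three of them dependent, are the images of the standard frame, up to
scalars. -/
theorem exists_frame {x y z u : Fin 3 → K} (h : det (of ![x, y, z]) ≠ 0)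
    (hx : det (of ![u, y, z]) ≠ 0) (hy : det (of ![x, u, z]) ≠ 0)
    (hz : det (of ![x, y, u]) ≠ 0) :
    ∃ (A : Matrix (Fin 3) (Fin 3) K) (a b c : K), A.det ≠ 0 ∧ a ≠ 0 ∧ b ≠ 0 ∧ c ≠ 0 ∧
      A *ᵥ ![1, 0, 0] = a • x ∧ A *ᵥ ![0, 1, 0] = b • y ∧ A *ᵥ ![0, 0, 1] = c • z ∧
      A *ᵥ ![1, 1, 1] = det (of ![x, y, z]) • u := by
  set a := det (of ![u, y, z]) with ha
  set b := det (of ![x, u, z]) with hb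
  set c := det (of ![x, y, u]) with hc
  refine ⟨(of ![a • x, b • y, c • z])ᵀ, a, b, c, ?_, hx, hy, hz, ?_, ?_, ?_, ?_⟩
  · have : det (of ![a • x, b • y, c • z]) = a * b * c * det (of ![x, y, z]) := by
      simp [det_fin_three]; ring
    rw [det_transpose, this]
    simp [hx, hy, hz, h]
  · ext i; simp [mulVec, dotProduct, Fin.sum_univ_three]
  · ext i; simp [mulVec, dotProduct, Fin.sum_univ_three]
  · ext i; simp [mulVec, dotProduct, Fin.sum_univ_three]
  · ext i
    simp only [mulVec, dotProduct, Fin.sum_univ_three, ha, hb, hc, det_fin_three]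
    fin_cases i <;> simp <;> ring

/-- A polarity of the plane `PG(2, K)`, whose points and lines are identified by means of the
dot product, regarded as a collineation. -/
def Polarity.toCollineation (ρ : Polarity (ℙ K (Fin 3 → K)) (ℙ K (Fin 3 → K))) :
    Collineation (ℙ K (Fin 3 → K)) (ℙ K (Fin 3 → K)) :=
  ⟨(ρ.polar, ρ.polar.symm), fun p l => by
    rw [← ρ.mem_iff p l]
    exact orthogonal_comm⟩

/-- The embedding preserves non-incidence, so a quadrangle of the subplane is a quadrangle of the
big plane; no embedding of `k` into `K` is needed. -/
theorem Collineation.FixesSubplane.exists_frame {k : Type*} [Field k]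
    {α : Collineation (ℙ K (Fin 3 → K)) (ℙ K (Fin 3 → K))}
    (hD : α.FixesSubplane (ℙ k (Fin 3 → k)) (ℙ k (Fin 3 → k))) :
    ∃ A : Matrix (Fin 3) (Fin 3) K, A.det ≠ 0 ∧
      α.Sends (A *ᵥ ![1, 0, 0]) (A *ᵥ ![1, 0, 0]) ∧
      α.Sends (A *ᵥ ![0, 1, 0]) (A *ᵥ ![0, 1, 0]) ∧
      α.Sends (A *ᵥ ![0, 0, 1]) (A *ᵥ ![0, 0, 1]) ∧
      α.Sends (A *ᵥ ![1, 1, 1]) (A *ᵥ ![1, 1, 1]) := by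
  obtain ⟨f, g, hfg, hf⟩ := hD
  have key : ∀ {p q r l : ℙ k (Fin 3 → k)}, p ∈ l → q ∈ l → p ≠ q → r ∉ l →
      det (of ![(f p).rep, (f q).rep, (f r).rep]) ≠ 0 := by
    intro p q r l hp hq hpq hr h
    obtain ⟨m, hm, hm'⟩ := exists_mulVec_eq_zero_iff.2 h
    have e : ∀ {x : ℙ k (Fin 3 → k)}, (f x).rep ⬝ᵥ m = 0 → f x ∈ mk K m hm := by
      intro x hx
      rw [← mk_rep (f x)]
      exact hx
    have e1 := e (congrFun hm' 0)
    have e2 := e (congrFun hm' 1)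
    have e3 := e (congrFun hm' 2)
    have e4 := (Nondegenerate.eq_or_eq e1 e2 ((hfg _ _).2 hp) ((hfg _ _).2 hq)).resolve_left
      (f.injective.ne hpq)
    rw [e4] at e3
    exact hr ((hfg _ _).1 e3)
  have fix : ∀ p {a : K}, a ≠ 0 → α.Sends (a • (f p).rep) (a • (f p).rep) := by
    intro p a ha
    have : α.Sends (f p).rep (f p).rep := ⟨rep_nonzero _, rep_nonzero _, by rw [mk_rep, hf]⟩
    exact this.smul ha ha
  let p0 : ℙ k (Fin 3 → k) := mk k ![1, 0, 0] (by simp)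
  let p1 : ℙ k (Fin 3 → k) := mk k ![0, 1, 0] (by simp)
  let p2 : ℙ k (Fin 3 → k) := mk k ![0, 0, 1] (by simp)
  let pu : ℙ k (Fin 3 → k) := mk k ![1, 1, 1] (by simp)
  have n01 : p0 ≠ p1 := by simp [p0, p1, mk_eq_mk_iff']
  have n12 : p1 ≠ p2 := by simp [p1, p2, mk_eq_mk_iff']
  have n02 : p0 ≠ p2 := by simp [p0, p2, mk_eq_mk_iff']
  have h := key (p := p0) (q := p1) (r := p2) (l := p2) (by simp [p0, p2, mk_mem_mk_iff])
    (by simp [p1, p2, mk_mem_mk_iff]) n01 (by simp [p2, mk_mem_mk_iff])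
  have hx := key (p := p1) (q := p2) (r := pu) (l := p0) (by simp [p0, p1, mk_mem_mk_iff])
    (by simp [p0, p2, mk_mem_mk_iff]) n12 (by simp [p0, pu, mk_mem_mk_iff])
  have hy := key (p := p0) (q := p2) (r := pu) (l := p1) (by simp [p0, p1, mk_mem_mk_iff])
    (by simp [p1, p2, mk_mem_mk_iff]) n02 (by simp [p1, pu, mk_mem_mk_iff])
  have hz := key (p := p0) (q := p1) (r := pu) (l := p2) (by simp [p0, p2, mk_mem_mk_iff])
    (by simp [p1, p2, mk_mem_mk_iff]) n01 (by simp [p2, pu, mk_mem_mk_iff])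
  obtain ⟨A, a, b, c, hA, ha, hb, hc, e0, e1, e2, eu⟩ := FigueroaPlane.exists_frame h
    (u := (f pu).rep) (fun h' => hx (by rw [← h']; simp [det_fin_three]; ring))
    (fun h' => hy (by rw [← neg_eq_zero, ← h']; simp [det_fin_three]; ring)) hz
  refine ⟨A, hA, ?_, ?_, ?_, ?_⟩
  · rw [e0]; exact fix _ ha
  · rw [e1]; exact fix _ hb
  · rw [e2]; exact fix _ hc
  · rw [eu]; exact fix _ h

/-- In suitable coordinates, a collineation fixing a subplane is a field automorphism; a polarity
is semilinear. -/
theorem exists_coordinates [Finite K] {k : Type*} [Field k]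
    {α : Collineation (ℙ K (Fin 3 → K)) (ℙ K (Fin 3 → K))}
    (hD : α.FixesSubplane (ℙ k (Fin 3 → k)) (ℙ k (Fin 3 → k)))
    (ρ : Polarity (ℙ K (Fin 3 → K)) (ℙ K (Fin 3 → K))) :
    ∃ (A B : Matrix (Fin 3) (Fin 3) K) (s t : K ≃+* K), A.det ≠ 0 ∧ B.det ≠ 0 ∧
      (∀ v : Fin 3 → K, v ≠ 0 → α.Sends (A *ᵥ v) (A *ᵥ (s ∘ v))) ∧
      ∀ v : Fin 3 → K, v ≠ 0 → ρ.toCollineation.Sends (A *ᵥ v) (B *ᵥ (t ∘ v)) := by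
  obtain ⟨A, hA, h0, h1, h2, hu⟩ := hD.exists_frame
  obtain ⟨s, hs⟩ := Collineation.exists_semilinear_of_frame hA hA h0 h1 h2 hu
  obtain ⟨a, ha⟩ := exists_collineation_mulVec hA
  have ex : ∀ {v : Fin 3 → K}, v ≠ 0 → ∃ w, (ρ.toCollineation * a).Sends v w :=
    fun hv => Collineation.exists_sends _ hv
  obtain ⟨x, hx⟩ := ex (v := ![1, 0, 0]) (by simp)
  obtain ⟨y, hy⟩ := ex (v := ![0, 1, 0]) (by simp)
  obtain ⟨z, hz⟩ := ex (v := ![0, 0, 1]) (by simp)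
  obtain ⟨u, hu⟩ := ex (v := ![1, 1, 1]) (by simp)
  have h := hx.det_ne_zero hy hz (by simp [det_fin_three])
  obtain ⟨B, b0, b1, b2, hB, n0, n1, n2, e0, e1, e2, eu⟩ := exists_frame h
    (hu.det_ne_zero hy hz (by simp [det_fin_three]))
    (hx.det_ne_zero hu hz (by simp [det_fin_three]))
    (hx.det_ne_zero hy hu (by simp [det_fin_three]))
  have key : ∀ {v w w' : Fin 3 → K} {b : K}, b ≠ 0 → (ρ.toCollineation * a).Sends v w →
      w' = b • w → ρ.toCollineation.Sends (A *ᵥ v) w' := by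
    rintro v w w' b hb h rfl
    have h' := h.smul one_ne_zero hb
    rw [one_smul] at h'
    have := (ha v h.choose).symm.trans h'
    rwa [mul_inv_cancel_right] at this
  obtain ⟨t, ht⟩ := Collineation.exists_semilinear_of_frame hA hB (key n0 hx e0) (key n1 hy e1)
    (key n2 hz e2) (key h hu eu)
  exact ⟨A, B, s, t, hA, hB, hs, ht⟩

end Frames

open Configuration

/-! ### Reflexive sesquilinear forms and their normalization. -/

section Forms

open Matrix Projectivization

variable {K : Type*} [Field K]

/-- The multiplicative group of a finite field is cyclic, so automorphisms act on it as power maps.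
-/
theorem ringEquiv_commute [Finite K] (s t : K ≃+* K) (x : K) : s (t x) = t (s x) := by
  obtain ⟨m, hm⟩ := MonoidHom.map_cyclic (Units.map (s : K →* K))
  obtain ⟨n, hn⟩ := MonoidHom.map_cyclic (Units.map (t : K →* K))
  rcases eq_or_ne x 0 with rfl | hx
  · simp
  · have key : Units.map (s : K →* K) (Units.map (t : K →* K) (Units.mk0 x hx)) =
        Units.map (t : K →* K) (Units.map (s : K →* K) (Units.mk0 x hx)) := by
      rw [hm, hn, hn, hm, zpow_comm]
    exact congrArg Units.val key

/-- The sesquilinear form with Gram matrix `G` and companion automorphism `t`. -/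
def sesq (G : Matrix (Fin 3) (Fin 3) K) (t : K ≃+* K) (v w : Fin 3 → K) : K :=
  v ⬝ᵥ G *ᵥ (t ∘ w)

section Sesq

variable (G : Matrix (Fin 3) (Fin 3) K) (t : K ≃+* K) (u v w : Fin 3 → K)

theorem comp_add : t ∘ (v + w) = t ∘ v + t ∘ w := by ext; simp

theorem comp_smul (a : K) : t ∘ (a • v) = t a • (t ∘ v) := by ext; simp

theorem sesq_add_left : sesq G t (u + v) w = sesq G t u w + sesq G t v w := add_dotProduct ..

theorem sesq_smul_left (a : K) : sesq G t (a • v) w = a * sesq G t v w := smul_dotProduct ..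

theorem sesq_add_right : sesq G t u (v + w) = sesq G t u v + sesq G t u w := by
  simp only [sesq, comp_add, mulVec_add, dotProduct_add]

theorem sesq_smul_right (a : K) : sesq G t v (a • w) = t a * sesq G t v w := by
  simp only [sesq, comp_smul, mulVec_smul, dotProduct_smul, smul_eq_mul]

theorem map_dotProduct_mulVec (s : K ≃+* K) :
    s (v ⬝ᵥ G *ᵥ w) = (s ∘ v) ⬝ᵥ (G.map s) *ᵥ (s ∘ w) := by
  simp only [dotProduct, mulVec, Fin.sum_univ_three, map_add, map_mul, Function.comp, map_apply]

variable {G t}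

theorem map_sesq [Finite K] {s : K ≃+* K} (hs : G.map s = G) :
    s (sesq G t v w) = sesq G t (s ∘ v) (s ∘ w) := by
  rw [sesq, map_dotProduct_mulVec, hs, sesq]
  congr 2
  ext i
  exact ringEquiv_commute s t _

theorem sesq_comm (ht : ∀ x, t (t x) = x) (hG : (G.map t)ᵀ = G) :
    sesq G t w v = t (sesq G t v w) := by
  rw [sesq, sesq, map_dotProduct_mulVec]
  nth_rewrite 1 [← hG]
  have : t ∘ t ∘ w = w := by ext; simp [ht]
  rw [this, mulVec_transpose, dotProduct_comm, ← dotProduct_mulVec]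

theorem exists_sesq_ne_zero (hG : G.det ≠ 0) (hv : v ≠ 0) :
    ∃ w : Fin 3 → K, (∀ s : K ≃+* K, s ∘ w = w) ∧ sesq G t v w ≠ 0 := by
  by_contra! h
  have : v ᵥ* G ≠ 0 := fun h' => hG (exists_vecMul_eq_zero_iff.1 ⟨v, hv, h'⟩)
  apply this
  ext i
  have hi : ∀ s : K ≃+* K, s ∘ (Pi.single i 1 : Fin 3 → K) = Pi.single i 1 := by
    intro s; ext j; rcases eq_or_ne j i with rfl | hj <;> simp [*]
  have := h (Pi.single i 1) hi
  rwa [sesq, hi, dotProduct_mulVec, dotProduct_single_one] at this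

end Sesq

/-- Forms with the same orthogonality relation are proportional. -/
theorem eq_smul_of_orthogonality {G N : Matrix (Fin 3) (Fin 3) K} (hG : G.det ≠ 0) (r : K ≃+* K)
    (h : ∀ v w, v ⬝ᵥ G *ᵥ w = 0 → v ⬝ᵥ N *ᵥ (r ∘ w) = 0) :
    ∃ a : K, N = a • G ∧ ∀ x, a * r x = a * x := by
  have hG' : IsUnit G.det := isUnit_iff_ne_zero.2 hG
  set D := G⁻¹ * N with hD
  have hN : N = G * D := by rw [hD, mul_nonsing_inv_cancel_left _ _ hG']
  have key : ∀ v w, v ⬝ᵥ w = 0 → v ⬝ᵥ D *ᵥ (r ∘ w) = 0 := by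
    intro v w hvw
    have e := h (v ᵥ* G⁻¹) w (by
      rwa [dotProduct_mulVec, vecMul_vecMul, nonsing_inv_mul _ hG', vecMul_one])
    rwa [hN, dotProduct_mulVec, vecMul_vecMul, nonsing_inv_mul_cancel_left _ _ hG',
      ← dotProduct_mulVec] at e
  have e01 := key ![1, 0, 0] ![0, 1, 0] (by simp)
  have e02 := key ![1, 0, 0] ![0, 0, 1] (by simp)
  have e10 := key ![0, 1, 0] ![1, 0, 0] (by simp)
  have e12 := key ![0, 1, 0] ![0, 0, 1] (by simp)
  have e20 := key ![0, 0, 1] ![1, 0, 0] (by simp)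
  have e21 := key ![0, 0, 1] ![0, 1, 0] (by simp)
  -- Basis vectors show that D is diagonal. These pairs equate its diagonal entries and force the
  -- twist r to be trivial unless the scalar is zero.
  have f1 := fun x => key ![x, -1, 0] ![1, x, 0] (by simp)
  have f2 := key ![1, 0, -1] ![1, 0, 1] (by simp)
  simp [mulVec, dotProduct, Fin.sum_univ_three] at e01 e02 e10 e12 e20 e21 f1 f2
  simp only [e01, e02, e10, e20] at f1 f2
  have g1 := f1 1
  simp at g1
  have e11 : D 1 1 = D 0 0 := by linear_combination -g1
  have e22 : D 2 2 = D 0 0 := by linear_combination -f2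
  have hD1 : D = D 0 0 • (1 : Matrix (Fin 3) (Fin 3) K) := by
    ext i j; fin_cases i <;> fin_cases j <;> simp [e01, e02, e10, e12, e20, e21, e11, e22]
  refine ⟨D 0 0, ?_, fun x => ?_⟩
  · rw [hN]
    conv_lhs => rw [hD1]
    simp
  · have := f1 x
    rw [e11] at this
    linear_combination -this

/-- If all vectors with entries 0 and 1 tested here were isotropic, G would be alternating of odd
size, hence singular. -/
theorem exists_rational_nonisotropic {G : Matrix (Fin 3) (Fin 3) K} (hG : G.det ≠ 0) :
    ∃ u : Fin 3 → K, (∀ s : K ≃+* K, s ∘ u = u) ∧ u ⬝ᵥ G *ᵥ u ≠ 0 := by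
  by_contra! h
  have e0 := h ![1, 0, 0] (fun s => by ext i; fin_cases i <;> simp)
  have e1 := h ![0, 1, 0] (fun s => by ext i; fin_cases i <;> simp)
  have e2 := h ![0, 0, 1] (fun s => by ext i; fin_cases i <;> simp)
  have e01 := h ![1, 1, 0] (fun s => by ext i; fin_cases i <;> simp)
  have e12 := h ![0, 1, 1] (fun s => by ext i; fin_cases i <;> simp)
  have e02 := h ![1, 0, 1] (fun s => by ext i; fin_cases i <;> simp)
  simp [mulVec, dotProduct, Fin.sum_univ_three] at e0 e1 e2 e01 e12 e02
  simp only [e0, e1, e2, zero_add, add_zero] at e01 e12 e02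
  apply hG
  rw [det_fin_three, e0, e1, e2, eq_neg_of_add_eq_zero_left e01, eq_neg_of_add_eq_zero_left e12,
    eq_neg_of_add_eq_zero_left e02]
  ring

/-- A reflexive form that is invariant up to scalars under `s` is proportional to a Hermitian form
defined over the fixed field of `s`. -/
theorem exists_hermitian_of_reflexive [Finite K] {G : Matrix (Fin 3) (Fin 3) K} (hG : G.det ≠ 0)
    {s t : K ≃+* K} (h2 : ∀ v w, sesq G t v w = 0 → sesq G t (s ∘ v) (s ∘ w) = 0)
    (h3 : ∀ v w, sesq G t v w = 0 → sesq G t w v = 0) :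
    (∀ x, t (t x) = x) ∧
      ∃ a : K, a ≠ 0 ∧ (a • G).map s = a • G ∧ ((a • G).map t)ᵀ = a • G := by
  have hc : ∀ (r : K ≃+* K) (z : Fin 3 → K), r ∘ r.symm ∘ z = z := by intro r z; ext; simp
  have hc' : ∀ (r : K ≃+* K) (M : Matrix (Fin 3) (Fin 3) K), (M.map r.symm).map r = M := by
    intro r M; ext; simp
  have hc'' : ∀ (r : K ≃+* K) (M : Matrix (Fin 3) (Fin 3) K), (M.map r).map r.symm = M := by
    intro r M; ext; simp
  obtain ⟨l, hl, -⟩ := eq_smul_of_orthogonality (N := G.map s.symm) hG (RingEquiv.refl K) (by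
    intro v w hvw
    have e := h2 v (t.symm ∘ w) (by rwa [sesq, hc])
    have e' : t ∘ s ∘ t.symm ∘ w = s ∘ w := by
      ext i
      simp [← ringEquiv_commute s t]
    rw [sesq, e'] at e
    apply s.injective
    rw [map_dotProduct_mulVec, map_zero, hc']
    exact e)
  -- Reflexivity compares G with its conjugate transpose, up to the twist t⁻². This twist is trivial
  -- once m ≠ 0, whence t² = 1.
  obtain ⟨m, hm, hmt⟩ := eq_smul_of_orthogonality (N := Gᵀ.map t.symm) hG (t.symm.trans t.symm) (by
    intro v w hvw
    have e := h3 v (t.symm ∘ w) (by rwa [sesq, hc])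
    apply t.injective
    rw [map_dotProduct_mulVec, map_zero, hc']
    have e' : t ∘ (t.symm.trans t.symm) ∘ w = t.symm ∘ w := by ext; simp
    rw [e', mulVec_transpose, dotProduct_comm, ← dotProduct_mulVec]
    exact e)
  -- As u is fixed by every automorphism, its value g satisfies s⁻¹(g) = l g and t⁻¹(g) = m g.
  -- Dividing G by g removes both multipliers at once.
  obtain ⟨u, hu, hu0⟩ := exists_rational_nonisotropic hG
  set g := u ⬝ᵥ G *ᵥ u with hg
  have es : s.symm g = l * g := by
    rw [hg, map_dotProduct_mulVec, hu, hl, smul_mulVec, dotProduct_smul, smul_eq_mul]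
  have et : t.symm g = m * g := by
    have : g = u ⬝ᵥ Gᵀ *ᵥ u := by
      rw [mulVec_transpose, dotProduct_comm, ← dotProduct_mulVec]
    conv_lhs => rw [this]
    rw [map_dotProduct_mulVec, hu, hm, smul_mulVec, dotProduct_smul, smul_eq_mul]
  have hm0 : m ≠ 0 := by
    rintro rfl
    rw [zero_mul] at et
    exact hu0 ((map_eq_zero t.symm).1 et)
  have hl0 : l ≠ 0 := by
    rintro rfl
    rw [zero_mul] at es
    exact hu0 ((map_eq_zero s.symm).1 es)
  have hmap : ∀ (r : K ≃+* K) (a : K) (M : Matrix (Fin 3) (Fin 3) K),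
      (a • M).map r = r a • M.map r := by intro r a M; ext; simp
  refine ⟨fun x => ?_, g⁻¹, inv_ne_zero hu0, ?_, ?_⟩
  · have := mul_left_cancel₀ hm0 (hmt (t (t x)))
    simpa using this.symm
  · have e : (g⁻¹ • G).map s.symm = g⁻¹ • G := by
      rw [hmap, hl, map_inv₀, es, smul_smul]
      congr 1
      field_simp
    conv_lhs => rw [← e]
    exact hc' s _
  · have e : ((g⁻¹ • G)ᵀ).map t.symm = g⁻¹ • G := by
      rw [transpose_smul, hmap, hm, map_inv₀, et, smul_smul]
      congr 1
      field_simp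
    have e2 : (((g⁻¹ • G)ᵀ).map t.symm).map t = (g⁻¹ • G)ᵀ := hc' t _
    rw [e] at e2
    rw [e2, transpose_transpose]

end Forms

open Configuration

/-! ### Standard Hermitian coordinates over the fixed field of `s`. -/

section NormalForm

open Matrix Projectivization

variable {K : Type*} [Field K]

/-- The standard Hermitian form `v₀ t(w₂) + v₁ t(w₁) + v₂ t(w₀)`. -/
def herm (t : K ≃+* K) (v w : Fin 3 → K) : K :=
  v 0 * t (w 2) + v 1 * t (w 1) + v 2 * t (w 0)

/-- Frobenius is bijective; uniqueness of square roots makes the root as rational as c. -/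
theorem exists_sq_eq [Finite K] [CharP K 2] {c : K} : ∃ r : K, r ^ 2 = c ∧
    ∀ s : K ≃+* K, s c = c → s r = r := by
  have : Fact (Nat.Prime 2) := ⟨Nat.prime_two⟩
  obtain ⟨r, hr⟩ := (Finite.injective_iff_surjective.1 (frobenius_inj K 2)) c
  refine ⟨r, hr, fun s hs => frobenius_inj K 2 ?_⟩
  rw [frobenius_def, ← map_pow, ← frobenius_def, hr, hs]

theorem exists_smul_eq_of_dotProduct_eq_zero {x y p r : Fin 3 → K} (hx : x ≠ 0)
    (hpr : crossProduct p r ≠ 0) (h1 : x ⬝ᵥ p = 0) (h2 : y ⬝ᵥ p = 0) (h3 : x ⬝ᵥ r = 0)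
    (h4 : y ⬝ᵥ r = 0) : ∃ a : K, a • x = y := by
  rcases eq_or_ne y 0 with rfl | hy
  · exact ⟨0, zero_smul _ _⟩
  · have := (ofField.crossProduct_eq_zero_of_dotProduct_eq_zero h1 h2 h3 h4).resolve_right hpr
    rw [← mk_eq_mk_iff_crossProduct_eq_zero hx hy, eq_comm, mk_eq_mk_iff'] at this
    exact this

variable {G : Matrix (Fin 3) (Fin 3) K} {s t : K ≃+* K}

/-- If e = (1,0,0) has norm a ≠ 0, take a rational u orthogonal to e with norm c. With r² = c/a, the
vector u + r e has norm c + c = 0. -/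
theorem exists_isotropic [Finite K] [CharP K 2] (ht : ∀ x, t (t x) = x) (hs : G.map s = G)
    (hGt : (G.map t)ᵀ = G) :
    ∃ p : Fin 3 → K, p ≠ 0 ∧ s ∘ p = p ∧ sesq G t p p = 0 := by
  have hent : ∀ i j, s (G i j) = G i j := fun i j => congrFun (congrFun hs i) j
  have hent' : ∀ i j, t (G j i) = G i j := fun i j => congrFun (congrFun hGt i) j
  set a := G 0 0 with ha
  by_cases ha0 : a = 0
  · refine ⟨![1, 0, 0], by simp, by ext i; fin_cases i <;> simp, ?_⟩
    simp [sesq, mulVec, dotProduct, Fin.sum_univ_three, ← ha, ha0]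
  set u : Fin 3 → K := ![-G 1 0, a, 0] with hu
  set e : Fin 3 → K := ![1, 0, 0] with he
  have hse : s ∘ e = e := by ext i; fin_cases i <;> simp [e]
  have hsu : s ∘ u = u := by ext i; fin_cases i <;> simp [u, hent, ha]
  have hue : sesq G t u e = 0 := by
    simp [sesq, mulVec, dotProduct, Fin.sum_univ_three, u, e, ← ha]; ring
  have heu : sesq G t e u = 0 := by rw [sesq_comm _ _ ht hGt, hue, map_zero]
  have hee : sesq G t e e = a := by
    simp [sesq, mulVec, dotProduct, Fin.sum_univ_three, e, ← ha]
  set c := sesq G t u u with hc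
  have hct : t c = c := (sesq_comm u u ht hGt).symm
  have hcs : s c = c := by rw [hc, map_sesq _ _ hs, hsu]
  have hat : t a = a := hent' 0 0
  obtain ⟨r, hr, hr'⟩ := exists_sq_eq (c := c / a)
  have hrs : s r = r := hr' s (by rw [map_div₀, hcs, hent])
  have hrt : t r = r := hr' t (by rw [map_div₀, hct, hat])
  refine ⟨u + r • e, fun h => ha0 ?_, ?_, ?_⟩
  · simpa [u, e] using congrFun h 1
  · rw [comp_add, comp_smul, hsu, hse, hrs]
  · rw [sesq_add_left, sesq_add_right, sesq_add_right, sesq_smul_left, sesq_smul_left,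
      sesq_smul_right, sesq_smul_right, hue, heu, hee, hrt, ← hc]
    have : r * (r * a) = c := by
      rw [← mul_assoc, ← sq, hr]; field_simp
    rw [this, mul_zero, add_zero, zero_add, CharTwo.add_self_eq_zero]

/-- Scale a vector to have product 1 with p, then add z p with z + t z equal to its norm c. The
element b moved by t provides such a z in Fix(s). -/
theorem exists_hyperbolic_partner [CharP K 2] [Finite K] (hG : G.det ≠ 0)
    (ht : ∀ x, t (t x) = x) (hs : G.map s = G)
    (hGt : (G.map t)ᵀ = G) {b : K} (hb : s b = b) (hb' : t b ≠ b) {p : Fin 3 → K} (hp : p ≠ 0)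
    (hps : s ∘ p = p) (hpp : sesq G t p p = 0) :
    ∃ r : Fin 3 → K, s ∘ r = r ∧ sesq G t r r = 0 ∧ sesq G t r p = 1 := by
  obtain ⟨w, hw, hpw⟩ := exists_sesq_ne_zero p hG hp
  have hwp : sesq G t w p ≠ 0 := by
    rw [sesq_comm _ _ ht hGt]
    exact (map_ne_zero_iff t t.injective).2 hpw
  set d := sesq G t w p with hd
  have hds : s d = d := by rw [hd, map_sesq _ _ hs, hps, hw]
  set r := d⁻¹ • w with hr
  have hrs : s ∘ r = r := by rw [hr, comp_smul, hw, map_inv₀, hds]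
  have hrp : sesq G t r p = 1 := by rw [hr, sesq_smul_left, ← hd, inv_mul_cancel₀ hwp]
  clear_value r
  have hpr : sesq G t p r = 1 := by rw [sesq_comm _ _ ht hGt, hrp, map_one]
  set c := sesq G t r r with hc
  have hct : t c = c := (sesq_comm r r ht hGt).symm
  have hcs : s c = c := by rw [hc, map_sesq _ _ hs, hrs]
  have hbt : b + t b ≠ 0 := fun h => hb' (CharTwo.add_eq_zero.1 h).symm
  have hstb : s (t b) = t b := by rw [ringEquiv_commute, hb]
  set z := c * b / (b + t b) with hz
  have hzs : s z = z := by simp only [hz, map_div₀, map_mul, map_add, hcs, hb, hstb]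
  have hzt : z + t z = c := by
    simp only [hz, map_div₀, map_mul, map_add, hct, ht]
    rw [add_comm (t b) b]
    field_simp
  refine ⟨r + z • p, by rw [comp_add, comp_smul s p, hrs, hps, hzs], ?_, ?_⟩
  · rw [sesq_add_left, sesq_add_right, sesq_add_right, sesq_smul_left, sesq_smul_left,
      sesq_smul_right, sesq_smul_right, hpp, hrp, hpr, ← hc]
    have h2 := CharTwo.add_self_eq_zero c
    linear_combination hzt + h2
  · rw [sesq_add_left, sesq_smul_left, hrp, hpp, mul_zero, add_zero]

/-- A Hermitian form over the fixed field of `s` in characteristic two has the standard form in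
coordinates defined over this fixed field. -/
theorem exists_herm_coordinates [CharP K 2] [Finite K] (hG : G.det ≠ 0)
    (ht : ∀ x, t (t x) = x) (hs : G.map s = G)
    (hGt : (G.map t)ᵀ = G) {b : K} (hb : s b = b) (hb' : t b ≠ b) :
    ∃ C : Matrix (Fin 3) (Fin 3) K, C.det ≠ 0 ∧ C.map s = C ∧
      ∀ v w, sesq G t (C *ᵥ v) (C *ᵥ w) = herm t v w := by
  obtain ⟨p, hp, hps, hpp⟩ := exists_isotropic ht hs hGt
  obtain ⟨r, hrs, hrr, hrp⟩ := exists_hyperbolic_partner hG ht hs hGt hb hb' hp hps hpp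
  have hpr : sesq G t p r = 1 := by rw [sesq_comm _ _ ht hGt, hrp, map_one]
  set p' := G *ᵥ (t ∘ p) with hp'
  set r' := G *ᵥ (t ∘ r) with hr'
  set e := crossProduct p' r' with he
  have hrat : ∀ v, s ∘ v = v → s ∘ (G *ᵥ (t ∘ v)) = G *ᵥ (t ∘ v) := by
    intro v hv
    ext i
    have : s ∘ t ∘ v = t ∘ v := by
      conv_rhs => rw [← hv]
      ext i; exact ringEquiv_commute s t _
    have h := map_dotProduct_mulVec G (Pi.single i 1) (t ∘ v) s
    rw [hs, this] at h
    have hi : s ∘ (Pi.single i 1 : Fin 3 → K) = Pi.single i 1 := by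
      ext j; rcases eq_or_ne j i with rfl | hj <;> simp [*]
    rw [hi, single_one_dotProduct] at h
    exact h
  have hes : s ∘ e = e := by
    have h1 := hrat p hps
    have h2 := hrat r hrs
    rw [← hp'] at h1
    rw [← hr'] at h2
    have h1' : ∀ i, s (p' i) = p' i := congrFun h1
    have h2' : ∀ i, s (r' i) = r' i := congrFun h2
    ext i
    fin_cases i <;> simp [e, cross_apply, h1', h2']
  -- By the Binet–Cauchy identity, (p × r) · e = −1.
  have he0 : e ≠ 0 := by
    intro h0
    have := cross_dot_cross p r p' r'
    rw [← he, h0, dotProduct_zero] at this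
    have e1 : p ⬝ᵥ p' = 0 := hpp
    have e2 : p ⬝ᵥ r' = 1 := hpr
    have e3 : r ⬝ᵥ p' = 1 := hrp
    rw [e1, e2, e3] at this
    simp at this
  have hep : sesq G t e p = 0 := by
    change e ⬝ᵥ p' = 0
    rw [dotProduct_comm]; exact dot_self_cross _ _
  have her : sesq G t e r = 0 := by
    change e ⬝ᵥ r' = 0
    rw [dotProduct_comm]; exact dot_cross_self _ _
  have hpe : sesq G t p e = 0 := by rw [sesq_comm _ _ ht hGt, hep, map_zero]
  have hre : sesq G t r e = 0 := by rw [sesq_comm _ _ ht hGt, her, map_zero]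
  -- Subtracting from w its components along p and r leaves a multiple of e. If e were isotropic it
  -- would be orthogonal to w, contrary to nondegeneracy.
  have hee : sesq G t e e ≠ 0 := by
    intro h0
    obtain ⟨w, -, hw⟩ := exists_sesq_ne_zero e hG he0
    set w' := w + (-sesq G t w p) • r + (-sesq G t w r) • p with hw'
    have h1 : sesq G t w' p = 0 := by
      rw [hw', sesq_add_left, sesq_add_left, sesq_smul_left, sesq_smul_left, hrp, hpp]; ring
    have h2 : sesq G t w' r = 0 := by
      rw [hw', sesq_add_left, sesq_add_left, sesq_smul_left, sesq_smul_left, hrr, hpr]; ring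
    obtain ⟨a, ha⟩ := exists_smul_eq_of_dotProduct_eq_zero he0 he0 hep h1 her h2
    apply hw
    have h3 : sesq G t e w' = sesq G t e w := by
      rw [hw', sesq_add_right, sesq_add_right, sesq_smul_right, sesq_smul_right, her, hep]; ring
    rw [← h3, ← ha, sesq_smul_right, h0, mul_zero]
  set c := sesq G t e e with hc
  have hct : t c = c := (sesq_comm e e ht hGt).symm
  have hcs : s c = c := by rw [hc, map_sesq _ _ hs, hes]
  obtain ⟨z, hz, hz'⟩ := exists_sq_eq (c := c⁻¹)
  have hzs : s z = z := hz' s (by rw [map_inv₀, hcs])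
  have hzt : t z = z := hz' t (by rw [map_inv₀, hct])
  have hzz : z * (z * c) = 1 := by
    rw [← mul_assoc, ← sq, hz, inv_mul_cancel₀ hee]
  set C : Matrix (Fin 3) (Fin 3) K := (of ![r, z • e, p])ᵀ with hC
  have hCv : ∀ v, C *ᵥ v = v 0 • r + v 1 • (z • e) + v 2 • p := by
    intro v; ext i
    simp [hC, mulVec, dotProduct, Fin.sum_univ_three]; ring
  have hform : ∀ v w, sesq G t (C *ᵥ v) (C *ᵥ w) = herm t v w := by
    intro v w
    simp only [hCv, sesq_add_left, sesq_add_right, sesq_smul_left, sesq_smul_right, hrr, hrp, hpr,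
      hpp, hep, her, hpe, hre, ← hc, hzt, herm]
    linear_combination (v 1 * t (w 1)) * hzz
  refine ⟨C, fun h => ?_, ?_, hform⟩
  · obtain ⟨v, hv, hv'⟩ := exists_mulVec_eq_zero_iff.2 h
    have h0 : ∀ w, herm t v w = 0 := by
      intro w
      rw [← hform, hv', sesq, zero_dotProduct]
    apply hv
    have h1 := h0 ![1, 0, 0]
    have h2 := h0 ![0, 1, 0]
    have h3 := h0 ![0, 0, 1]
    simp [herm] at h1 h2 h3
    ext i; fin_cases i <;> simp [h1, h2, h3]
  · have hp1 : ∀ i, s (p i) = p i := congrFun hps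
    have hr1 : ∀ i, s (r i) = r i := congrFun hrs
    have he1 : ∀ i, s (e i) = e i := congrFun hes
    ext i j
    fin_cases j <;> simp [hC, hp1, hr1, he1, hzs]

end NormalForm

open Configuration

/-! ### Fixed fields of field automorphisms. -/

section FixedFields

variable {K : Type*} [Field K]

/-- The fixed field of an automorphism. -/
def fixedField (s : K ≃+* K) : Subfield K where
  carrier := {x | s x = x}
  mul_mem' := by intro a b ha hb; exact (map_mul s a b).trans (congrArg₂ _ ha hb)
  one_mem' := map_one s
  add_mem' := by intro a b ha hb; exact (map_add s a b).trans (congrArg₂ _ ha hb)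
  zero_mem' := map_zero s
  neg_mem' := by intro a ha; exact (map_neg s a).trans (congrArg _ ha)
  inv_mem' := by intro a ha; exact (map_inv₀ s a).trans (congrArg _ ha)

theorem mem_fixedField {s : K ≃+* K} {x : K} : x ∈ fixedField s ↔ s x = x := Iff.rfl

/-- Artin's theorem: the degree of K over the fixed field is the order of the group generated by s.
-/
theorem natCard_fixedField_pow [Finite K] (s : K ≃+* K) :
    Nat.card (fixedField s) ^ orderOf s = Nat.card K := by
  classical
  let Z : Subgroup (RingAut K) := Subgroup.zpowers s
  have : Finite (RingAut K) := Finite.of_injective (fun r : K ≃+* K => (r : K → K)) DFunLike.coe_injective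
  let _ : Fintype Z := Fintype.ofFinite Z
  have h1 : FixedPoints.subfield Z K = fixedField s := by
    ext x
    refine ⟨fun h => h ⟨s, Subgroup.mem_zpowers s⟩, ?_⟩
    rintro h ⟨r, hr⟩
    have hs : s ∈ MulAction.stabilizer (RingAut K) x := h
    exact (Subgroup.zpowers_le.2 hs) hr
  have h2 := FixedPoints.finrank_eq_card Z K
  rw [← Nat.card_eq_fintype_card, Nat.card_zpowers] at h2
  rw [← h1, Module.natCard_eq_pow_finrank (K := FixedPoints.subfield Z K) (V := K), h2]

end FixedFields

/-! ### Order of `s`, and exclusion of symmetric bilinear forms. -/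

section Coordinates

open Matrix Projectivization

variable {K : Type*} [Field K]

/-- In characteristic 2 the cross terms cancel, and the quadratic form is the square of the linear
form with coefficients √(G i i). -/
theorem exists_linear_of_symmetric [Finite K] [CharP K 2] {G : Matrix (Fin 3) (Fin 3) K}
    (hG : G.det ≠ 0) (hs : Gᵀ = G) :
    ∃ l : Fin 3 → K, l ≠ 0 ∧ ∀ v, v ⬝ᵥ G *ᵥ v = 0 ↔ v ⬝ᵥ l = 0 := by
  choose r hr _ using fun c : K => exists_sq_eq (c := c)
  have key : ∀ v : Fin 3 → K, v ⬝ᵥ G *ᵥ v = (v ⬝ᵥ (fun i => r (G i i))) ^ 2 := by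
    intro v
    have e : ∀ i j, G i j = G j i := fun i j => congrFun (congrFun hs j) i
    have h2 : (2 : K) = 0 := CharTwo.two_eq_zero
    simp only [mulVec, dotProduct, Fin.sum_univ_three]
    rw [e 1 0, e 2 0, e 2 1]
    linear_combination (-(v 0) ^ 2) * hr (G 0 0) - (v 1) ^ 2 * hr (G 1 1)
      - (v 2) ^ 2 * hr (G 2 2) + (v 0 * v 1 * G 0 1 + v 0 * v 2 * G 0 2 + v 1 * v 2 * G 1 2
        - v 0 * v 1 * r (G 0 0) * r (G 1 1) - v 0 * v 2 * r (G 0 0) * r (G 2 2)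
        - v 1 * v 2 * r (G 1 1) * r (G 2 2)) * h2
  refine ⟨fun i => r (G i i), fun h => ?_, fun v => ?_⟩
  · obtain ⟨u, -, hu⟩ := exists_rational_nonisotropic hG
    rw [key, h, dotProduct_zero] at hu
    simp at hu
  · rw [key, sq_eq_zero_iff]

theorem Collineation.eq_one_of_pt {P L : Type*} [Membership P L] [ProjectivePlane P L] [Finite P]
    [Finite L] {α : Collineation P L} (h : ∀ p, α.pt p = p) : α = 1 := by
  have h' : ∀ l, α.ln l = l := by
    intro l
    have := ProjectivePlane.two_lt_pointCount (P := P) l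
    have : 1 < Nat.card {p : P // p ∈ l} := by unfold pointCount at this; omega
    obtain ⟨⟨p, hp⟩, ⟨q, hq⟩, hpq⟩ := Finite.one_lt_card_iff_nontrivial.1 this
    have e : ∀ {p}, p ∈ l → p ∈ α.ln l := fun {p} hp => by
      rw [← h p]; exact α.pt_mem_ln_iff.2 hp
    exact (Nondegenerate.eq_or_eq (e hp) (e hq) hp hq).resolve_left fun h => hpq (Subtype.ext h)
  exact Subtype.ext (Prod.ext (Equiv.ext h) (Equiv.ext h'))

theorem Collineation.pt_pt_pt {P L : Type*} [Membership P L] {α : Collineation P L}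
    (h : orderOf α = 3) (x : P) : α.pt (α.pt (α.pt x)) = x := by
  have h3 : α ^ 3 = 1 := by rw [← h, pow_orderOf_eq_one]
  exact congrArg (fun a : Collineation P L => a.pt x) h3

variable {α : Collineation (ℙ K (Fin 3 → K)) (ℙ K (Fin 3 → K))}
  {ρ : Polarity (ℙ K (Fin 3 → K)) (ℙ K (Fin 3 → K))} {A : Matrix (Fin 3) (Fin 3) K}

theorem orderOf_ringEquiv_eq_three [DecidableEq K] [Finite K] (hα : orderOf α = 3) {s : K ≃+* K}
    (hA : A.det ≠ 0) (hs : ∀ v : Fin 3 → K, v ≠ 0 → α.Sends (A *ᵥ v) (A *ᵥ (s ∘ v))) :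
    orderOf s = 3 := by
  have : Fact (Nat.Prime 3) := ⟨Nat.prime_three⟩
  have hinj := mulVec_injective_iff_isUnit.2 ((isUnit_iff_isUnit_det A).2 (isUnit_iff_ne_zero.2 hA))
  have hs0 : ∀ {v : Fin 3 → K}, v ≠ 0 → s ∘ v ≠ 0 := by
    rintro v hv h
    exact hv (funext fun i => (map_eq_zero s).1 (congrFun h i))
  refine orderOf_eq_prime ?_ ?_
  · ext x
    -- The leading coordinate 1 fixes the scalar, so α³ = 1 gives s³ x = x.
    have hv : ![1, x, 0] ≠ 0 := by simp
    have h1 := hs _ hv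
    have h2 := hs _ (hs0 hv)
    have h3 := hs _ (hs0 (hs0 hv))
    obtain ⟨n0, n1, h1⟩ := h1
    obtain ⟨_, n2, h2⟩ := h2
    obtain ⟨_, n3, h3⟩ := h3
    rw [← h2, ← h1, Collineation.pt_pt_pt hα, eq_comm, mk_eq_mk_iff'] at h3
    obtain ⟨a, ha⟩ := h3
    rw [← mulVec_smul] at ha
    have ha := hinj ha
    have e0 := congrFun ha 0
    have e1 := congrFun ha 1
    simp at e0 e1
    rw [e0, one_mul] at e1
    exact e1.symm
  · rintro rfl
    have : α = 1 := by
      refine Collineation.eq_one_of_pt fun p => ?_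
      induction p with | h v hv =>
      obtain ⟨c, hc⟩ := exists_collineation_mulVec hA
      obtain ⟨w, hw⟩ := c⁻¹.exists_sends hv
      have hw0 := hw.choose_spec.choose
      obtain ⟨n1, n2, h⟩ := hs w hw0
      obtain ⟨n3, n4, h'⟩ := hw.symm
      obtain ⟨n5, n6, h''⟩ := hc w hw0
      rw [inv_inv] at h'
      rw [← h', h'']
      exact h
    rw [this, orderOf_one] at hα
    omega

/-- The absolute points would form a line, with n² + 1 points instead of n³ + 1. -/
theorem Polarity.not_isUnitary_of_symmetric [DecidableEq K] [Finite K] [CharP K 2]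
    (hA : A.det ≠ 0) {G : Matrix (Fin 3) (Fin 3) K} (hG : G.det ≠ 0) (hs : Gᵀ = G)
    (h : ∀ v (hv : A *ᵥ v ≠ 0), ρ.IsAbsolute (Projectivization.mk K (A *ᵥ v) hv) ↔ v ⬝ᵥ G *ᵥ v = 0) :
    ¬ ρ.IsUnitary := by
  rintro ⟨n, hn, hn'⟩
  have hA' : IsUnit A.det := isUnit_iff_ne_zero.2 hA
  obtain ⟨l, hl, hl'⟩ := exists_linear_of_symmetric hG hs
  have hl0 : A⁻¹ᵀ *ᵥ l ≠ 0 := by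
    intro h0
    have : Aᵀ *ᵥ A⁻¹ᵀ *ᵥ l = l := by
      rw [mulVec_mulVec, ← transpose_mul, nonsing_inv_mul _ hA', transpose_one, one_mulVec]
    rw [h0, mulVec_zero] at this
    exact hl this.symm
  have e : {p | ρ.IsAbsolute p} = {p | p ∈ Projectivization.mk K (A⁻¹ᵀ *ᵥ l) hl0} := by
    ext p
    induction p with | h v hv =>
    have hv' : A *ᵥ (A⁻¹ *ᵥ v) = v := by rw [mulVec_mulVec, mul_nonsing_inv _ hA', one_mulVec]
    have h1 := h (A⁻¹ *ᵥ v) (by rwa [hv'])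
    simp only [hv'] at h1
    rw [Set.mem_ofPred_eq, h1, hl', Set.mem_ofPred_eq, mk_mem_mk_iff, mulVec_transpose,
      dotProduct_comm v, ← dotProduct_mulVec, dotProduct_comm]
  rw [e] at hn'
  have e2 : {p | p ∈ Projectivization.mk K (A⁻¹ᵀ *ᵥ l) hl0}.ncard = _ :=
    ProjectivePlane.pointCount_eq (P := ℙ K (Fin 3 → K)) (Projectivization.mk K (A⁻¹ᵀ *ᵥ l) hl0)
  have h1 := ProjectivePlane.one_lt_order (ℙ K (Fin 3 → K)) (ℙ K (Fin 3 → K))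
  rw [hn', hn] at e2
  rw [hn] at h1
  have h2 : 1 < n := by nlinarith
  nlinarith [Nat.pow_lt_pow_right h2 (show 2 < 3 by norm_num)]

end Coordinates

open Configuration

/-! ### Simultaneous normal form of the collineation and the polarity. -/

section HermitianCoordinates

open Matrix Projectivization

variable {K : Type*} [Field K]

theorem charP_two_of_even_card [Fintype K] (h : Even (Fintype.card K)) : CharP K 2 := by
  have := (FiniteField.even_card_iff_char_two (F := K)).2 (Nat.even_iff.1 h)
  exact this ▸ ringChar.charP K

/-- An automorphism of order two does not fix the fixed field of an automorphism of order three. -/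
theorem exists_mem_fixedField_ne [Finite K] {q : ℕ} (hK : Nat.card K = q ^ 6) {s t : K ≃+* K}
    (hs : orderOf s = 3) (ht : orderOf t = 2) : ∃ b, s b = b ∧ t b ≠ b := by
  by_contra! h
  have hq : 1 < q := by
    have := Finite.one_lt_card (α := K)
    rw [hK] at this
    by_contra! hq
    have := Nat.pow_le_pow_left hq 6
    omega
  have h1 := natCard_fixedField_pow s
  have h2 := natCard_fixedField_pow t
  rw [hs, hK, show q ^ 6 = (q ^ 2) ^ 3 by ring] at h1
  rw [ht, hK, show q ^ 6 = (q ^ 3) ^ 2 by ring] at h2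
  have h1 := Nat.pow_left_injective (by norm_num : 3 ≠ 0) h1
  have h2 := Nat.pow_left_injective (by norm_num : 2 ≠ 0) h2
  -- A field of order q³ would then contain one of order q², making q³ a power of q².
  have hle : fixedField s ≤ fixedField t := fun x hx => h x hx
  let _ := (Subfield.inclusion hle).toAlgebra
  have h3 := Module.natCard_eq_pow_finrank (K := fixedField s) (V := fixedField t)
  rw [h1, h2, ← pow_mul] at h3
  have := Nat.pow_right_injective hq h3
  omega

variable {α : Collineation (ℙ K (Fin 3 → K)) (ℙ K (Fin 3 → K))}
  {ρ : Polarity (ℙ K (Fin 3 → K)) (ℙ K (Fin 3 → K))}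

theorem Polarity.mem_polar_iff_sesq {A B : Matrix (Fin 3) (Fin 3) K} {t : K ≃+* K}
    (ht : ∀ v : Fin 3 → K, v ≠ 0 → ρ.toCollineation.Sends (A *ᵥ v) (B *ᵥ (t ∘ v)))
    {v w : Fin 3 → K} (hv : A *ᵥ v ≠ 0) (hw : A *ᵥ w ≠ 0) :
    Projectivization.mk K (A *ᵥ v) hv ∈ ρ.polar (Projectivization.mk K (A *ᵥ w) hw) ↔
      sesq (Aᵀ * B) t v w = 0 := by
  have hw0 : w ≠ 0 := by rintro rfl; simp at hw
  obtain ⟨_, hB, h⟩ := ht w hw0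
  replace h : ρ.polar (Projectivization.mk K (A *ᵥ w) hw) =
    Projectivization.mk K (B *ᵥ (t ∘ w)) hB := h
  rw [h, mk_mem_mk_iff, sesq, ← mulVec_mulVec, dotProduct_mulVec v, vecMul_transpose]

/-- A unitary polarity and a collineation fixing a subplane which commute have a common standard
form. -/
theorem exists_hermitian_coordinates [Fintype K] [DecidableEq K] {q : ℕ} (hq : Even q)
    (hK : Fintype.card K = q ^ 6) {k : Type*} [Field k] (hρ : ρ.IsUnitary) (hα : orderOf α = 3)
    (hD : α.FixesSubplane (ℙ k (Fin 3 → k)) (ℙ k (Fin 3 → k))) (hcomm : ρ.CommutesWith α) :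
    ∃ (A : Matrix (Fin 3) (Fin 3) K) (s t : K ≃+* K), A.det ≠ 0 ∧ orderOf s = 3 ∧
      orderOf t = 2 ∧ (∀ v : Fin 3 → K, v ≠ 0 → α.Sends (A *ᵥ v) (A *ᵥ (s ∘ v))) ∧
      ∀ v w (hv : A *ᵥ v ≠ 0) (hw : A *ᵥ w ≠ 0),
        mk K (A *ᵥ v) hv ∈ ρ.polar (mk K (A *ᵥ w) hw) ↔ herm t v w = 0 := by
  have : CharP K 2 := charP_two_of_even_card (by rw [hK]; exact hq.pow_of_ne_zero (by norm_num))
  obtain ⟨A, B, s, t, hA, hB, hs, ht⟩ := exists_coordinates hD ρ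
  have hA0 : ∀ {v : Fin 3 → K}, v ≠ 0 → A *ᵥ v ≠ 0 := by
    intro v hv h
    exact hA (exists_mulVec_eq_zero_iff.1 ⟨v, hv, h⟩)
  have hs3 := orderOf_ringEquiv_eq_three hα hA hs
  have hG : (Aᵀ * B).det ≠ 0 := by
    rw [det_mul, det_transpose]; exact mul_ne_zero hA hB
  have hsesq0 : ∀ v, sesq (Aᵀ * B) t 0 v = 0 ∧ sesq (Aᵀ * B) t v 0 = 0 := by
    intro v
    have := sesq_smul_right (Aᵀ * B) t v 0 0
    rw [zero_smul, map_zero, zero_mul] at this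
    exact ⟨zero_dotProduct _, this⟩
  obtain ⟨htt, a, ha, has, hat⟩ := exists_hermitian_of_reflexive (s := s) (t := t) hG (by
    intro v w h
    rcases eq_or_ne v 0 with rfl | hv
    · rw [show s ∘ (0 : Fin 3 → K) = 0 by ext; simp, (hsesq0 _).1]
    rcases eq_or_ne w 0 with rfl | hw
    · rw [show s ∘ (0 : Fin 3 → K) = 0 by ext; simp, (hsesq0 _).2]
    rw [← ρ.mem_polar_iff_sesq ht (hA0 hv) (hA0 hw), ← α.pt_mem_ln_iff, ← hcomm] at h
    obtain ⟨_, hv', e1⟩ := hs v hv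
    obtain ⟨_, hw', e2⟩ := hs w hw
    rwa [e1, e2, ρ.mem_polar_iff_sesq ht] at h) (by
    intro v w h
    rcases eq_or_ne v 0 with rfl | hv
    · exact (hsesq0 w).2
    rcases eq_or_ne w 0 with rfl | hw
    · exact (hsesq0 v).1
    rw [← ρ.mem_polar_iff_sesq ht (hA0 hv) (hA0 hw), ρ.mem_polar_comm] at h
    rwa [ρ.mem_polar_iff_sesq ht] at h)
  have hmem : ∀ v w (hv : A *ᵥ v ≠ 0) (hw : A *ᵥ w ≠ 0),
      mk K (A *ᵥ v) hv ∈ ρ.polar (mk K (A *ᵥ w) hw) ↔ sesq (a • (Aᵀ * B)) t v w = 0 := by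
    intro v w hv hw
    rw [ρ.mem_polar_iff_sesq ht hv hw, sesq, sesq, smul_mulVec, dotProduct_smul, smul_eq_zero_iff_right ha]
  have hG' : (a • (Aᵀ * B)).det ≠ 0 := by
    rw [det_smul]; exact mul_ne_zero (pow_ne_zero _ ha) hG
  generalize a • (Aᵀ * B) = G at has hat hmem hG'
  have ht2 : orderOf t = 2 := by
    have : Fact (Nat.Prime 2) := ⟨Nat.prime_two⟩
    refine orderOf_eq_prime (RingEquiv.ext htt) ?_
    rintro rfl
    refine ρ.not_isUnitary_of_symmetric hA hG' hat (fun v hv => hmem v v hv hv) hρ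
  obtain ⟨b, hb, hb'⟩ := exists_mem_fixedField_ne (by rw [Nat.card_eq_fintype_card, hK]) hs3 ht2
  obtain ⟨C, hC, hCs, hCh⟩ := exists_herm_coordinates hG' htt has hat hb hb'
  have hC0 : ∀ {v : Fin 3 → K}, v ≠ 0 → C *ᵥ v ≠ 0 := by
    intro v hv h
    exact hC (exists_mulVec_eq_zero_iff.1 ⟨v, hv, h⟩)
  refine ⟨A * C, s, t, ?_, hs3, ht2, fun v hv => ?_, fun v w hv hw => ?_⟩
  · rw [det_mul]; exact mul_ne_zero hA hC
  · have h1 := hs (C *ᵥ v) (hC0 hv)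
    -- C has entries in Fix(s), so the change of basis leaves the description of `α` intact.
    have h2 : s ∘ (C *ᵥ v) = C *ᵥ (s ∘ v) := by
      ext i
      have := RingHom.map_mulVec (s : K →+* K) C v i
      have h3 : C.map (s : K →+* K) = C := hCs
      rw [h3] at this
      exact this
    rwa [h2, mulVec_mulVec, mulVec_mulVec] at h1
  · simp only [← mulVec_mulVec] at hv hw ⊢
    rw [hmem, hCh]

end HermitianCoordinates

/-! ### Balance of φ along traces and norms. -/

section Counting

open Finset

variable {K : Type*} [Field K] [Fintype K]

open Classical in
/-- The elements of a subfield of a finite field. -/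
noncomputable def elems (M : Subfield K) : Finset K := univ.filter (· ∈ M)

theorem mem_elems {M : Subfield K} {x : K} : x ∈ elems M ↔ x ∈ M := by simp [elems]

theorem card_elems (M : Subfield K) : (elems M).card = Nat.card M := by
  classical
  rw [Nat.card_eq_fintype_card, Fintype.card_subtype, elems]

variable (φ : K →+ ZMod 2)

/-- The number of solutions in `M` of `φ ((f x)⁻¹) = 1`. -/
noncomputable def oddCount (M : Subfield K) (f : K → K) : ℕ :=
  ((elems M).filter fun x => φ (f x)⁻¹ = 1).card

theorem zmod_two_ne_one {a : ZMod 2} : ¬ a = 1 ↔ a + 1 = 1 := by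
  revert a; decide

variable {φ} (hφ : φ 1 = 1)


include hφ in
-- With 0⁻¹ = 0, x ↦ (x + c)⁻¹ permutes M; translation by 1 exchanges the two values of φ on M.
theorem oddCount_add {M : Subfield K} {c : K} (hc : c ∈ M) :
    2 * oddCount φ M (fun x => x + c) = (elems M).card := by
  classical
  have e1 : oddCount φ M (fun x => x + c) = ((elems M).filter fun x => φ x = 1).card := by
    refine card_bij (fun x _ => (x + c)⁻¹) ?_ ?_ ?_
    · intro x hx
      simp only [mem_filter, mem_elems] at hx ⊢
      exact ⟨M.inv_mem (M.add_mem hx.1 hc), hx.2⟩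
    · intro x _ y _ h
      exact add_right_cancel (inv_injective h)
    · intro y hy
      simp only [mem_filter, mem_elems] at hy
      refine ⟨y⁻¹ - c, ?_, by simp⟩
      simp only [mem_filter, mem_elems, sub_add_cancel, inv_inv]
      exact ⟨M.sub_mem (M.inv_mem hy.1) hc, hy.2⟩
  have e2 : ((elems M).filter fun x => ¬ φ x = 1).card =
      ((elems M).filter fun x => φ x = 1).card := by
    refine card_bij (fun x _ => x + 1) ?_ ?_ ?_
    · intro x hx
      simp only [mem_filter, mem_elems] at hx ⊢
      exact ⟨M.add_mem hx.1 M.one_mem, by rw [map_add, hφ]; exact zmod_two_ne_one.1 hx.2⟩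
    · intro x _ y _ h
      exact add_right_cancel h
    · intro y hy
      simp only [mem_filter, mem_elems] at hy
      refine ⟨y - 1, ?_, by simp⟩
      simp only [mem_filter, mem_elems, map_sub, hφ]
      exact ⟨M.sub_mem hy.1 M.one_mem, by rw [hy.2, sub_self]; decide⟩
  have := card_filter_add_card_filter_not (s := elems M) (fun x => φ x = 1)
  rw [e2, ← e1] at this
  omega


variable {t : K ≃+* K} (ht : ∀ x, t (t x) = x) {E : Subfield K}

include ht in
-- Each fibre is a translate of the kernel of y ↦ y + t y on E, which is E ∩ Fix(t) in
-- characteristic 2.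
theorem card_trace_fiber [DecidableEq K] [CharP K 2] {b : K} (hb : b ∈ E) (hb' : t b ≠ b) (hE : ∀ x ∈ E, t x ∈ E)
    {c : K} (hc : c ∈ E ⊓ fixedField t) :
    ((elems E).filter fun y => y + t y = c).card = (elems (E ⊓ fixedField t)).card := by
  classical
  have hbt : b + t b ≠ 0 := fun h => hb' (CharTwo.add_eq_zero.1 h).symm
  set z := c * b / (b + t b) with hz
  have hct : t c = c := hc.2
  have hzE : z ∈ E := E.div_mem (E.mul_mem hc.1 hb) (E.add_mem hb (hE b hb))
  have hzt : z + t z = c := by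
    simp only [hz, map_div₀, map_mul, map_add, hct, ht]
    rw [add_comm (t b) b]
    field_simp
  refine card_bij (fun y _ => y - z) ?_ ?_ ?_
  · intro y hy
    simp only [mem_filter, mem_elems] at hy ⊢
    refine ⟨E.sub_mem hy.1 hzE, mem_fixedField.2 ?_⟩
    rw [map_sub]
    have h2 : (2 : K) = 0 := CharTwo.two_eq_zero
    linear_combination hy.2 - hzt - (y - z) * h2
  · intro x _ y _ h
    exact sub_left_injective h
  · intro y hy
    simp only [mem_elems] at hy
    have hyt : t y = y := hy.2
    refine ⟨y + z, ?_, by simp⟩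
    simp only [mem_filter, mem_elems, map_add, hyt]
    refine ⟨E.add_mem hy.1 hzE, ?_⟩
    have h2 : (2 : K) = 0 := CharTwo.two_eq_zero
    linear_combination hzt + y * h2

include ht in
/-- Counting along the fibres of the trace. -/
theorem sum_trace [CharP K 2] {b : K} (hb : b ∈ E) (hb' : t b ≠ b) (hE : ∀ x ∈ E, t x ∈ E)
    (g : K → ℕ) :
    ∑ y ∈ elems E, g (y + t y) =
      (elems (E ⊓ fixedField t)).card * ∑ c ∈ elems (E ⊓ fixedField t), g c := by
  classical
  rw [← sum_fiberwise_of_maps_to (s := elems E) (t := elems (E ⊓ fixedField t))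
    (g := fun y => y + t y), mul_sum]
  · refine sum_congr rfl fun c hc => ?_
    rw [sum_congr rfl (g := fun _ => g c) (by intro y hy; rw [(mem_filter.1 hy).2]), sum_const,
      card_trace_fiber ht hb hb' hE (mem_elems.1 hc), smul_eq_mul]
  · intro y hy
    rw [mem_elems] at hy ⊢
    refine ⟨E.add_mem hy (hE y hy), mem_fixedField.2 ?_⟩
    rw [map_add, ht, add_comm]

include ht in
theorem card_eq_card_fixed_mul [CharP K 2] {b : K} (hb : b ∈ E) (hb' : t b ≠ b)
    (hE : ∀ x ∈ E, t x ∈ E) :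
    (elems E).card = (elems (E ⊓ fixedField t)).card * (elems (E ⊓ fixedField t)).card := by
  have := sum_trace ht hb hb' hE (fun _ => 1)
  simpa using this

theorem oddCount_eq_sum (M : Subfield K) (f : K → K) :
    oddCount φ M f = ∑ x ∈ elems M, if φ (f x)⁻¹ = 1 then 1 else 0 := by
  rw [oddCount, card_filter]

include hφ ht in
theorem oddCount_trace [CharP K 2] {b : K} (hb : b ∈ E) (hb' : t b ≠ b) (hE : ∀ x ∈ E, t x ∈ E)
    {c : K} (hc : c ∈ E ⊓ fixedField t) :
    2 * oddCount φ E (fun y => y + t y + c) = (elems E).card := by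
  rw [oddCount_eq_sum, sum_trace ht hb hb' hE (fun n => if φ (n + c)⁻¹ = 1 then 1 else 0),
    ← oddCount_eq_sum (f := fun n => n + c), card_eq_card_fixed_mul ht hb hb' hE,
    ← oddCount_add hφ hc]
  ring

/-- Dividing by the t-fixed square root of n carries the fibre over n to the fibre over 1. -/
theorem card_norm_fiber [DecidableEq K] [CharP K 2] {n : K} (hn : n ∈ E ⊓ fixedField t) (hn0 : n ≠ 0)
    (hsq : ∀ r, r ^ 2 ∈ E → r ∈ E) :
    ((elems E).filter fun x => x * t x = n).card =
      ((elems E).filter fun x => x * t x = 1).card := by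
  classical
  obtain ⟨r, hr, hr'⟩ := exists_sq_eq (c := n)
  have hrt : t r = r := hr' t hn.2
  have hrE : r ∈ E := hsq r (by rw [hr]; exact hn.1)
  have hr0 : r ≠ 0 := by rintro rfl; exact hn0 (by rw [← hr]; simp)
  refine card_bij (fun x _ => x / r) ?_ ?_ ?_
  · intro x hx
    simp only [mem_filter, mem_elems] at hx ⊢
    refine ⟨E.div_mem hx.1 hrE, ?_⟩
    rw [map_div₀, hrt, div_mul_div_comm, hx.2, ← hr, sq]
    field_simp
  · intro x _ y _ h
    exact (div_left_inj' hr0).1 h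
  · intro y hy
    simp only [mem_filter, mem_elems] at hy
    refine ⟨y * r, ?_, by field_simp⟩
    simp only [mem_filter, mem_elems, map_mul, hrt]
    refine ⟨E.mul_mem hy.1 hrE, ?_⟩
    linear_combination r ^ 2 * hy.2 + hr

include ht in
/-- Counting along the fibres of the norm. -/
theorem sum_norm [CharP K 2] {b : K} (hb : b ∈ E) (hb' : t b ≠ b) (hE : ∀ x ∈ E, t x ∈ E)
    (hsq : ∀ r, r ^ 2 ∈ E → r ∈ E) (g : K → ℕ) :
    ∑ y ∈ elems E, g (y * t y) + (elems (E ⊓ fixedField t)).card * g 0 =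
      ((elems (E ⊓ fixedField t)).card + 1) * ∑ c ∈ elems (E ⊓ fixedField t), g c := by
  classical
  set M := E ⊓ fixedField t with hM
  set κ := ((elems E).filter fun x => x * t x = 1).card with hκ
  have hmaps : ∀ y ∈ elems E, y * t y ∈ elems M := by
    intro y hy
    rw [mem_elems] at hy ⊢
    refine ⟨E.mul_mem hy (hE y hy), mem_fixedField.2 ?_⟩
    rw [map_mul, ht, mul_comm]
  have h0 : (0 : K) ∈ elems M := mem_elems.2 M.zero_mem
  have h0f : ((elems E).filter fun x => x * t x = 0) = {0} := by
    ext x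
    simp only [mem_filter, mem_elems, mem_singleton, mul_eq_zero, map_eq_zero, or_self]
    exact ⟨fun h => h.2, fun h => ⟨h ▸ E.zero_mem, h⟩⟩
  have key : ∀ g : K → ℕ, ∑ y ∈ elems E, g (y * t y) = κ * ∑ c ∈ (elems M).erase 0, g c + g 0 := by
    intro g
    rw [← sum_fiberwise_of_maps_to hmaps, ← sum_erase_add _ _ h0, mul_sum, h0f]
    congr 1
    · refine sum_congr rfl fun c hc => ?_
      rw [mem_erase, mem_elems] at hc
      rw [sum_congr rfl (g := fun _ => g c) (by intro y hy; rw [(mem_filter.1 hy).2]), sum_const,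
        card_norm_fiber hc.2 hc.1 hsq, smul_eq_mul]
    · simp
  -- With m = |E ∩ Fix(t)|, counting E gives m² = κ(m − 1) + 1, so κ = m + 1. Zero has a single
  -- preimage, which explains the extra term m g(0) in the statement.
  have hcard := key fun _ => 1
  simp only [sum_const, smul_eq_mul, mul_one, card_erase_of_mem h0] at hcard
  rw [card_eq_card_fixed_mul ht hb hb' hE, ← hM] at hcard
  have h1 : 1 < (elems M).card :=
    one_lt_card.2 ⟨0, h0, 1, mem_elems.2 M.one_mem, zero_ne_one⟩
  obtain ⟨m, hm⟩ : ∃ m, (elems M).card = m + 2 := ⟨_, (Nat.sub_add_cancel h1).symm⟩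
  have hκ' : κ = (elems M).card + 1 := by
    rw [hm] at hcard ⊢
    have : (m + 1) * κ = (m + 1) * (m + 2 + 1) := by
      have e : m + 2 - 1 = m + 1 := rfl
      rw [e] at hcard
      linarith
    exact Nat.eq_of_mul_eq_mul_left (Nat.succ_pos m) this
  rw [key g, ← sum_erase_add _ _ h0, hκ']
  ring

include hφ ht in
-- For a single e the count is biased through the lone preimage of norm 0, depending on φ(e⁻¹). The
-- bias averages out over e in M. A general M allows E = K and E = Fix(s) to be compared over the
-- same e.
theorem sum_oddCount_norm [CharP K 2] {b : K} (hb : b ∈ E) (hb' : t b ≠ b)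
    (hE : ∀ x ∈ E, t x ∈ E) (hsq : ∀ r, r ^ 2 ∈ E → r ∈ E) {M : Subfield K}
    (hM : M ≤ E ⊓ fixedField t) :
    2 * ∑ e ∈ elems M, oddCount φ E (fun x => x * t x + e) = (elems M).card * (elems E).card := by
  have h1 : ∀ e ∈ elems M, 2 * oddCount φ E (fun x => x * t x + e) +
      2 * ((elems (E ⊓ fixedField t)).card * (if φ (0 + e)⁻¹ = 1 then 1 else 0)) =
      ((elems (E ⊓ fixedField t)).card + 1) * (elems (E ⊓ fixedField t)).card := by
    intro e he
    have := sum_norm ht hb hb' hE hsq (fun n => if φ (n + e)⁻¹ = 1 then 1 else 0)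
    rw [← oddCount_eq_sum (f := fun x => x * t x + e),
      ← oddCount_eq_sum (f := fun n => n + e)] at this
    have h2 := oddCount_add hφ (hM (mem_elems.1 he))
    rw [← mul_add, this, ← mul_assoc, mul_comm 2, mul_assoc, h2]
  have h2 := sum_congr rfl h1
  have h3 : 2 * ∑ e ∈ elems M, (if φ (0 + e)⁻¹ = 1 then 1 else 0) = (elems M).card := by
    simp only [zero_add]
    have := oddCount_add hφ M.zero_mem
    rw [oddCount_eq_sum] at this
    simpa using this
  rw [sum_add_distrib, sum_const, smul_eq_mul, ← mul_sum, ← mul_sum, ← mul_sum] at h2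
  rw [card_eq_card_fixed_mul ht hb hb' hE]
  have h4 : 2 * ((elems (E ⊓ fixedField t)).card *
      ∑ e ∈ elems M, (if φ (0 + e)⁻¹ = 1 then 1 else 0)) =
      (elems (E ⊓ fixedField t)).card * (elems M).card := by
    rw [← h3]; ring
  rw [h4] at h2
  linarith

end Counting

/-! ### Size of the Desarguesian set and of its part with collinear orbits. -/

section PairCounting

open Finset

variable {K : Type*} [Field K] [Fintype K] [DecidableEq K] (φ : K →+ ZMod 2)

/-- The number of solutions outside of `M` of `φ ((f x)⁻¹) = 1`. -/
noncomputable def oddCountCompl (M : Subfield K) (f : K → K) : ℕ :=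
  (((elems M)ᶜ).filter fun x => φ (f x)⁻¹ = 1).card

theorem oddCountCompl_add (M : Subfield K) (f : K → K) :
    oddCountCompl φ M f + oddCount φ M f = oddCount φ ⊤ f := by
  have h : elems (⊤ : Subfield K) = (elems M)ᶜ ∪ elems M := by
    ext x; simp [mem_elems, or_comm, em]
  rw [oddCount, oddCount, oddCountCompl, h, filter_union, card_union_of_disjoint]
  exact disjoint_filter_filter disjoint_compl_left

omit [DecidableEq K] in
theorem card_elems_top : (elems (⊤ : Subfield K)).card = Fintype.card K := by
  have : elems (⊤ : Subfield K) = univ := by ext; simp [mem_elems]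
  rw [this, card_univ]

/-- The affine coordinates of the points in the triangle-free set of the Desarguesian plane. -/
def oddPairs (t : K ≃+* K) : Finset (K × K) :=
  univ.filter fun p => φ (p.2 + t p.2 + p.1 * t p.1)⁻¹ = 1

/-- The pairs that are not fixed by `s` and satisfy an affine equation over the fixed field. -/
def collinearPairs (s t : K ≃+* K) : Finset (K × K) :=
  (oddPairs φ t).filter fun p => ¬ (s p.1 = p.1 ∧ s p.2 = p.2) ∧
    (s p.1 - p.1) * (s (s p.2) - p.2) = (s (s p.1) - p.1) * (s p.2 - p.2)

variable {φ} {s t : K ≃+* K}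

omit [DecidableEq K] in
theorem card_oddPairs [CharP K 2] (hφ : φ 1 = 1) (ht : ∀ x, t (t x) = x) {b : K}
    (hb' : t b ≠ b) : 2 * (oddPairs φ t).card = Fintype.card K * Fintype.card K := by
  have h1 : (oddPairs φ t).card =
      ∑ x : K, oddCount φ ⊤ (fun y => y + t y + x * t x) := by
    rw [oddPairs, card_filter, Fintype.sum_prod_type]
    refine sum_congr rfl fun x _ => ?_
    rw [oddCount, card_filter]
    exact sum_congr (by ext; simp [mem_elems]) fun _ _ => rfl
  have h2 : ∀ x ∈ (univ : Finset K), 2 * oddCount φ ⊤ (fun y => y + t y + x * t x) =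
      Fintype.card K := by
    intro x _
    rw [oddCount_trace hφ ht (E := ⊤) (b := b) trivial hb' (fun _ _ => trivial), card_elems_top]
    refine ⟨trivial, mem_fixedField.2 ?_⟩
    rw [map_mul, ht, mul_comm]
  rw [h1, mul_sum, sum_congr rfl h2, sum_const, card_univ, smul_eq_mul]

omit [Fintype K] [DecidableEq K] in
-- The hypothesis says that the slope (s y − y)/(s x − x) is fixed by s; then so is the intercept.
theorem affine_of_collinear {x y : K} (hx : s x ≠ x)
    (h : (s x - x) * (s (s y) - y) = (s (s x) - x) * (s y - y)) :
    ∃ a b, s a = a ∧ s b = b ∧ y = a * x + b := by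
  have hx' : s x - x ≠ 0 := sub_ne_zero.2 hx
  have hsx' : s (s x) - s x ≠ 0 := sub_ne_zero.2 fun h => hx (s.injective h)
  have ha : s ((s y - y) / (s x - x)) = (s y - y) / (s x - x) := by
    rw [map_div₀, map_sub, map_sub, div_eq_div_iff hsx' hx']
    linear_combination h
  refine ⟨(s y - y) / (s x - x), y - (s y - y) / (s x - x) * x, ha, ?_, by ring⟩
  rw [map_sub, map_mul, ha]
  field_simp
  ring

theorem sum_oddCountCompl_norm [CharP K 2] (hφ : φ 1 = 1) (ht : ∀ x, t (t x) = x) {b : K}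
    (hb : s b = b) (hb' : t b ≠ b) :
    2 * ∑ e ∈ elems (fixedField s ⊓ fixedField t),
        oddCountCompl φ (fixedField s) (fun x => x * t x + e) +
      (elems (fixedField s ⊓ fixedField t)).card * (elems (fixedField s)).card =
      (elems (fixedField s ⊓ fixedField t)).card * Fintype.card K := by
  have hE : ∀ x ∈ fixedField s, t x ∈ fixedField s := fun x hx => by
    rw [mem_fixedField, ringEquiv_commute, mem_fixedField.1 hx]
  have hsq : ∀ r, r ^ 2 ∈ fixedField s → r ∈ fixedField s := by
    intro r hr
    rw [mem_fixedField, map_pow] at hr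
    exact CharTwo.sq_injective hr
  rw [← sum_oddCount_norm hφ ht (E := fixedField s) hb hb' hE hsq le_rfl, ← mul_add,
    ← sum_add_distrib, ← card_elems_top,
    ← sum_oddCount_norm hφ ht (E := ⊤) (b := b) trivial hb' (fun _ _ => trivial)
      (fun _ _ => trivial) (M := fixedField s ⊓ fixedField t) (fun x hx => ⟨trivial, hx.2⟩)]
  simp only [oddCountCompl_add]

/-- Completing the norm: on y = a x + b the norm of the point is that of x + t a, plus a constant.
-/
theorem oddCountCompl_line {a b : K} (ht : ∀ x, t (t x) = x)
    (hta : t a ∈ fixedField s) :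
    oddCountCompl φ (fixedField s) (fun x => a * x + b + t (a * x + b) + x * t x) ≤
      oddCountCompl φ (fixedField s) (fun x => x * t x + (b + t b - a * t a)) := by
  refine card_le_card_of_injOn (fun x => x + t a) ?_ (fun x _ y _ h => add_right_cancel h)
  intro x hx
  simp only [coe_filter, Set.mem_ofPred_eq, mem_compl, mem_elems] at hx ⊢
  refine ⟨fun h => hx.1 ?_, ?_⟩
  · simpa using (fixedField s).sub_mem h hta
  · rw [← hx.2]
    congr 2
    simp only [map_add, map_mul, ht]
    ring

theorem card_collinearPairs_le [CharP K 2] (hφ : φ 1 = 1) (ht : ∀ x, t (t x) = x) {b : K}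
    (hb : s b = b) (hb' : t b ≠ b) {f : ℕ} (hf : (elems (fixedField s)).card = f) :
    2 * (collinearPairs φ s t).card + (f + f * f) * f ≤ (f + f * f) * Fintype.card K := by
  set F := fixedField s with hF
  have hE : ∀ x ∈ F, t x ∈ F := fun x hx => by
    rw [hF, mem_fixedField, ringEquiv_commute, mem_fixedField.1 hx]
  -- The lost points are covered by the f vertical and f² other affine lines over F, using only
  -- points not rational over F.
  have hsub : collinearPairs φ s t ⊆
      ((elems F).biUnion fun x => (((elems F)ᶜ).filter fun y =>
        φ (y + t y + x * t x)⁻¹ = 1).image fun y => (x, y)) ∪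
      ((elems F ×ˢ elems F).biUnion fun ab => (((elems F)ᶜ).filter fun x =>
        φ (ab.1 * x + ab.2 + t (ab.1 * x + ab.2) + x * t x)⁻¹ = 1).image
          fun x => (x, ab.1 * x + ab.2)) := by
    rintro ⟨x, y⟩ h
    simp only [collinearPairs, oddPairs, mem_filter, mem_univ, true_and] at h
    obtain ⟨h1, h2, h3⟩ := h
    rw [mem_union, mem_biUnion, mem_biUnion]
    by_cases hx : s x = x
    · left
      refine ⟨x, mem_elems.2 hx, mem_image.2 ⟨y, ?_, rfl⟩⟩
      rw [mem_filter, mem_compl, mem_elems]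
      exact ⟨fun hy => h2 ⟨hx, hy⟩, h1⟩
    · right
      obtain ⟨a, b, ha, hb, rfl⟩ := affine_of_collinear hx h3
      refine ⟨(a, b), mem_product.2 ⟨mem_elems.2 ha, mem_elems.2 hb⟩, mem_image.2 ⟨x, ?_, rfl⟩⟩
      rw [mem_filter, mem_compl, mem_elems]
      exact ⟨hx, h1⟩
  have hc1 : (collinearPairs φ s t).card ≤
      ∑ x ∈ elems F, oddCountCompl φ F (fun y => y + t y + x * t x) +
      ∑ a ∈ elems F, ∑ b ∈ elems F,
        oddCountCompl φ F (fun x => a * x + b + t (a * x + b) + x * t x) := by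
    rw [← sum_product (f := fun ab : K × K => oddCountCompl φ F
      (fun x => ab.1 * x + ab.2 + t (ab.1 * x + ab.2) + x * t x))]
    refine (card_le_card hsub).trans ((card_union_le _ _).trans (add_le_add ?_ ?_))
    · exact card_biUnion_le.trans (sum_le_sum fun _ _ => card_image_le)
    · exact card_biUnion_le.trans (sum_le_sum fun _ _ => card_image_le)
  have hvert : ∀ x ∈ elems F, 2 * oddCountCompl φ F (fun y => y + t y + x * t x) + f =
      Fintype.card K := by
    intro x hx
    have hx : x ∈ F := mem_elems.1 hx
    have hmem : x * t x ∈ F ⊓ fixedField t := by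
      refine ⟨F.mul_mem hx (hE x hx), mem_fixedField.2 ?_⟩
      rw [map_mul, ht, mul_comm]
    rw [← hf, ← oddCount_trace hφ ht (E := F) hb hb' hE hmem, ← mul_add, oddCountCompl_add,
      oddCount_trace hφ ht (E := ⊤) (b := b) trivial hb' (fun _ _ => trivial)
        ⟨trivial, hmem.2⟩, card_elems_top]
  have hs1 : 2 * ∑ x ∈ elems F, oddCountCompl φ F (fun y => y + t y + x * t x) + f * f =
      f * Fintype.card K := by
    have := sum_congr rfl hvert
    rwa [sum_add_distrib, ← mul_sum, sum_const, sum_const, smul_eq_mul, smul_eq_mul, hf] at this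
  set m := (elems (F ⊓ fixedField t)).card with hm
  set D := ∑ e ∈ elems (F ⊓ fixedField t), oddCountCompl φ F (fun x => x * t x + e) with hD
  -- As b runs over F, its trace takes each value in F ∩ Fix(t) exactly m times; subtracting a t(a)
  -- permutes these values.
  have hs2 : ∀ a ∈ elems F, ∑ b ∈ elems F,
      oddCountCompl φ F (fun x => a * x + b + t (a * x + b) + x * t x) ≤ m * D := by
    intro a ha
    have ha : a ∈ F := mem_elems.1 ha
    have hmem : a * t a ∈ F ⊓ fixedField t := by
      refine ⟨F.mul_mem ha (hE a ha), mem_fixedField.2 ?_⟩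
      rw [map_mul, ht, mul_comm]
    refine (sum_le_sum fun b _ => oddCountCompl_line ht (hE a ha)).trans ?_
    rw [sum_trace ht (E := F) hb hb' hE
      (fun n => oddCountCompl φ F (fun x => x * t x + (n - a * t a)))]
    refine Nat.mul_le_mul le_rfl (le_of_eq ?_)
    refine sum_bij (fun n _ => n - a * t a) ?_ (fun x _ y _ h => sub_left_injective h) ?_
      (fun _ _ => rfl)
    · intro n hn
      exact mem_elems.2 ((F ⊓ fixedField t).sub_mem (mem_elems.1 hn) hmem)
    · intro n hn
      exact ⟨n + a * t a, mem_elems.2 ((F ⊓ fixedField t).add_mem (mem_elems.1 hn) hmem), by simp⟩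
  have hs3 := sum_le_sum hs2
  rw [sum_const, smul_eq_mul, hf] at hs3
  have hmm : f = m * m := by rw [← hf]; exact card_eq_card_fixed_mul ht hb hb' hE
  have hDD : 2 * D + m * f = m * Fintype.card K := by
    have := sum_oddCountCompl_norm (s := s) hφ ht hb hb'
    rwa [← hF, hf] at this
  have e1 : 2 * (f * (m * D)) + f * f * f = f * f * Fintype.card K := by
    have : 2 * (f * (m * D)) + f * (m * m) * f = f * (m * m) * Fintype.card K := by
      calc _ = f * m * (2 * D + m * f) := by ring
        _ = _ := by rw [hDD]; ring
    rwa [← hmm] at this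
  have e2 : (f + f * f) * f = f * f + f * f * f := by ring
  have e3 : (f + f * f) * Fintype.card K = f * Fintype.card K + f * f * Fintype.card K := by ring
  omega

end PairCounting

open Configuration

/-! ### The triangle identity and the final count. -/

section Final

open Matrix Projectivization

variable {K : Type*} [Field K]

theorem exists_functional [CharP K 2] : ∃ φ : K →+ ZMod 2, φ 1 = 1 := by
  let _ : Algebra (ZMod 2) K := ZMod.algebra K 2
  obtain ⟨f, hf⟩ := Module.Projective.exists_dual_eq_one (ZMod 2) (one_ne_zero : (1 : K) ≠ 0)
  exact ⟨f.toAddMonoidHom, hf⟩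

/-- Three pairwise conjugate affine points satisfy a linear relation between the inverses of their
norms. -/
theorem sum_inv_herm_eq_zero [CharP K 2] {t : K ≃+* K} (ht : ∀ x, t (t x) = x)
    {x₁ y₁ x₂ y₂ x₃ y₃ : K} (h12 : herm t ![1, x₁, y₁] ![1, x₂, y₂] = 0)
    (h23 : herm t ![1, x₂, y₂] ![1, x₃, y₃] = 0) (h13 : herm t ![1, x₁, y₁] ![1, x₃, y₃] = 0)
    (n₁ : y₁ + t y₁ + x₁ * t x₁ ≠ 0) (n₃ : y₃ + t y₃ + x₃ * t x₃ ≠ 0) :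
    (y₁ + t y₁ + x₁ * t x₁)⁻¹ + (y₂ + t y₂ + x₂ * t x₂)⁻¹ + (y₃ + t y₃ + x₃ * t x₃)⁻¹ = 0 := by
  have h2 : (2 : K) = 0 := CharTwo.two_eq_zero
  simp [herm] at h12 h23 h13
  have k12 := congrArg t h12
  have k23 := congrArg t h23
  have k13 := congrArg t h13
  simp only [map_add, map_mul, map_zero, ht] at k12 k23 k13
  -- Conjugacy factors each norm. Over a common denominator the numerator becomes the first norm
  -- plus its conjugate `e1'`, which is zero as the norm is fixed by t.
  have e1 : y₁ + t y₁ + x₁ * t x₁ = (x₁ + x₃) * (t x₁ + t x₂) := by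
    linear_combination h12 + k23 + k13 - (t y₂ + x₁ * t x₂ + x₃ * t x₁ + y₃ + t x₂ * x₃) * h2
  have e1' : y₁ + t y₁ + x₁ * t x₁ = (t x₁ + t x₃) * (x₁ + x₂) := by
    linear_combination k12 + h23 + h13 - (y₂ + t x₁ * x₂ + t x₃ * x₁ + t y₃ + x₂ * t x₃) * h2
  have e2 : y₂ + t y₂ + x₂ * t x₂ = (t x₁ + t x₂) * (x₂ + x₃) := by
    linear_combination k12 + k13 + k23 - (t y₁ + y₃ + t x₁ * x₂ + t x₁ * x₃ + t x₂ * x₃) * h2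
  have e3 : y₃ + t y₃ + x₃ * t x₃ = (x₂ + x₃) * (t x₁ + t x₃) := by
    linear_combination k13 + k12 + h23 - (t y₁ + y₂ + t x₁ * x₃ + t x₁ * x₂ + x₂ * t x₃) * h2
  rw [e1] at e1' n₁
  rw [e3] at n₃
  rw [e1, e2, e3]
  obtain ⟨m₁, m₂⟩ := mul_ne_zero_iff.1 n₁
  obtain ⟨m₃, m₄⟩ := mul_ne_zero_iff.1 n₃
  field_simp
  linear_combination e1' + (t x₁ + t x₃) * (x₁ + x₂ + x₃) * h2

/-- Evenness of q makes the bound an integer, and q > 1 keeps the natural subtraction from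
truncating. -/
theorem exists_nat_bound {q : ℕ} (hq : Even q) (hq0 : 1 < q) :
    ∃ n : ℕ, 2 * n + (q ^ 2 + q ^ 2 * q ^ 2) * q ^ 6 =
        q ^ 6 * q ^ 6 + (q ^ 2 + q ^ 2 * q ^ 2) * q ^ 2 ∧
      (n : ℚ) = ((q : ℚ) ^ 12 - (q : ℚ) ^ 4 * ((q : ℚ) ^ 4 - 1) * ((q : ℚ) ^ 2 + 1)) / 2 := by
  have hle : (q ^ 2 + q ^ 2 * q ^ 2) * q ^ 6 ≤ q ^ 6 * q ^ 6 := by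
    refine Nat.mul_le_mul_right _ ?_
    have h1 : 1 ≤ q ^ 2 := Nat.one_le_pow _ _ (by omega)
    have h2 : 2 ≤ q ^ 2 := by nlinarith
    have h3 : q ^ 6 = q ^ 2 * (q ^ 2 * q ^ 2) := by ring
    rw [h3]
    generalize q ^ 2 = m at *
    nlinarith [Nat.mul_le_mul_left m h2, Nat.mul_le_mul h2 (le_refl (m * m))]
  have hev : 2 ∣ q ^ 6 * q ^ 6 + (q ^ 2 + q ^ 2 * q ^ 2) * q ^ 2 -
      (q ^ 2 + q ^ 2 * q ^ 2) * q ^ 6 := by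
    refine Nat.dvd_sub (dvd_add ?_ ?_) ?_
    · exact Dvd.dvd.mul_left (dvd_pow hq.two_dvd (by norm_num)) _
    · exact Dvd.dvd.mul_left (dvd_pow hq.two_dvd (by norm_num)) _
    · exact Dvd.dvd.mul_left (dvd_pow hq.two_dvd (by norm_num)) _
  obtain ⟨n, hn⟩ := hev
  have h1 : 2 * n + (q ^ 2 + q ^ 2 * q ^ 2) * q ^ 6 =
      q ^ 6 * q ^ 6 + (q ^ 2 + q ^ 2 * q ^ 2) * q ^ 2 := by
    rw [← hn]
    exact Nat.sub_add_cancel (hle.trans (Nat.le_add_right _ _))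
  refine ⟨n, h1, ?_⟩
  have h2 := congrArg (Nat.cast : ℕ → ℚ) h1
  push_cast at h2
  linear_combination h2 / 2

variable {α : Collineation (ℙ K (Fin 3 → K)) (ℙ K (Fin 3 → K))}
  {ρ : Polarity (ℙ K (Fin 3 → K)) (ℙ K (Fin 3 → K))}

/-- The coordinates of a point whose orbit is on a line satisfy a determinantal equation. -/
theorem collinear_equation {A : Matrix (Fin 3) (Fin 3) K} {s : K ≃+* K} (hA : A.det ≠ 0)
    (hs : ∀ v : Fin 3 → K, v ≠ 0 → α.Sends (A *ᵥ v) (A *ᵥ (s ∘ v))) {x y : K}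
    (h0 : A *ᵥ ![1, x, y] ≠ 0)
    (h : ∃ l : ℙ K (Fin 3 → K), mk K (A *ᵥ ![1, x, y]) h0 ∈ l ∧ α.pt (mk K (A *ᵥ ![1, x, y]) h0) ∈ l ∧
      α.pt (α.pt (mk K (A *ᵥ ![1, x, y]) h0)) ∈ l) :
    (s x - x) * (s (s y) - y) = (s (s x) - x) * (s y - y) := by
  obtain ⟨l, h1, h2, h3⟩ := h
  induction l with | h m hm =>
  have e : ∀ z w : K, s ∘ ![1, z, w] = ![1, s z, s w] := by
    intro z w; ext i; fin_cases i <;> simp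
  have hs' : ∀ z w, α.Sends (A *ᵥ ![1, z, w]) (A *ᵥ ![1, s z, s w]) := by
    intro z w
    rw [← e]
    exact hs _ (by simp)
  obtain ⟨_, n1, p1⟩ := hs' x y
  obtain ⟨_, n2, p2⟩ := hs' (s x) (s y)
  rw [p1] at h2 h3
  rw [p2] at h3
  have hm' : Aᵀ *ᵥ m ≠ 0 := by
    intro h
    exact hA (by rw [← det_transpose]; exact exists_mulVec_eq_zero_iff.1 ⟨m, hm, h⟩)
  have key : ∀ v : Fin 3 → K, (A *ᵥ v) ⬝ᵥ m = 0 → v ⬝ᵥ (Aᵀ *ᵥ m) = 0 := by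
    intro v hv
    rwa [dotProduct_mulVec, vecMul_transpose]
  have hdet : det (of ![![1, x, y], ![1, s x, s y], ![1, s (s x), s (s y)]]) = 0 := by
    refine exists_mulVec_eq_zero_iff.1 ⟨_, hm', ?_⟩
    ext i
    fin_cases i
    · exact key _ h1
    · exact key _ h2
    · exact key _ h3
  simp [det_fin_three] at hdet
  linear_combination hdet

/-- The Figueroa plane of order `q ^ 6` has a large set of non-absolute points that induces a
triangle-free subgraph of the polarity graph. -/
theorem exists_triangleFree_set {q : ℕ} (hq : Even q)
    [Fintype K] [DecidableEq K] (hK : Fintype.card K = q ^ 6) {k : Type*} [Field k]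
    (hρ : ρ.IsUnitary)
    (hα : orderOf α = 3)
    (hD : α.FixesSubplane (ℙ k (Fin 3 → k)) (ℙ k (Fin 3 → k)))
    (hcomm : ρ.CommutesWith α) :
    ∃ S : Set (ℙ K (Fin 3 → K)),
      (∀ x ∈ S, ¬ (ρ.figueroa α hcomm).IsAbsolute x) ∧
      ((ρ.figueroa α hcomm).graph.induce S).CliqueFree 3 ∧
      (S.ncard : ℚ) =
        ((q : ℚ) ^ 12 - (q : ℚ) ^ 4 * ((q : ℚ) ^ 4 - 1) * ((q : ℚ) ^ 2 + 1)) / 2 := by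
  have hchar : CharP K 2 :=
    charP_two_of_even_card (by rw [hK]; exact hq.pow_of_ne_zero (by norm_num))
  have hq1 : 1 < q := by
    have := Fintype.one_lt_card (α := K)
    rw [hK] at this
    by_contra! hq
    have := Nat.pow_le_pow_left hq 6
    omega
  obtain ⟨A, s, t, hA, hs3, ht2, hs, hherm⟩ := exists_hermitian_coordinates hq hK hρ hα hD hcomm
  have hKn : Nat.card K = q ^ 6 := by rw [Nat.card_eq_fintype_card, hK]
  obtain ⟨b, hb, hb'⟩ := exists_mem_fixedField_ne hKn hs3 ht2
  have ht : ∀ x, t (t x) = x := by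
    have : t ^ 2 = 1 := by rw [← ht2, pow_orderOf_eq_one]
    exact fun x => congrArg (fun r : K ≃+* K => r x) this
  have h3 := Collineation.pt_pt_pt hα
  obtain ⟨φ, hφ⟩ := exists_functional (K := K)
  have hA0 : ∀ x y : K, A.mulVec ![1, x, y] ≠ 0 := by
    intro x y h
    exact hA (Matrix.exists_mulVec_eq_zero_iff.1 ⟨_, by simp, h⟩)
  have hinj := Matrix.mulVec_injective_iff_isUnit.2
    ((Matrix.isUnit_iff_isUnit_det A).2 (isUnit_iff_ne_zero.2 hA))
  set P : K × K → ℙ K (Fin 3 → K) := fun p => mk K (A.mulVec ![1, p.1, p.2]) (hA0 _ _) with hP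
  have hPinj : Function.Injective P := by
    rintro ⟨x, y⟩ ⟨x', y'⟩ h
    rw [hP] at h
    simp only [mk_eq_mk_iff'] at h
    obtain ⟨a, ha⟩ := h
    rw [← Matrix.mulVec_smul] at ha
    have ha := hinj ha
    have e0 := congrFun ha 0
    have e1 := congrFun ha 1
    have e2 := congrFun ha 2
    simp at e0 e1 e2
    subst e0
    simp at e1 e2
    rw [e1, e2]
  have hpol : ∀ p r, P p ∈ ρ.polar (P r) ↔ herm t ![1, p.1, p.2] ![1, r.1, r.2] = 0 :=
    fun p r => hherm _ _ _ _
  have hodd : ∀ p ∈ oddPairs φ t, φ (p.2 + t p.2 + p.1 * t p.1)⁻¹ = 1 := by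
    intro p hp
    simpa [oddPairs] using hp
  -- With 0⁻¹ = 0 and φ(0) = 0, points of norm zero are excluded automatically.
  have hne : ∀ p ∈ oddPairs φ t, p.2 + t p.2 + p.1 * t p.1 ≠ 0 := by
    intro p hp h
    have := hodd p hp
    rw [h, _root_.inv_zero, map_zero] at this
    exact zero_ne_one this
  set T : Set (ℙ K (Fin 3 → K)) := P '' (oddPairs φ t) with hT
  have hT1 : ∀ x ∈ T, x ∉ ρ.polar x := by
    rintro _ ⟨p, hp, rfl⟩ h
    rw [hpol] at h
    apply hne p hp
    simp [herm] at h
    linear_combination h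
  have hT3 : ∀ x ∈ T, ∀ y ∈ T, ∀ z ∈ T,
      x ∈ ρ.polar y → y ∈ ρ.polar z → x ∈ ρ.polar z → False := by
    rintro _ ⟨p, hp, rfl⟩ _ ⟨r, hr, rfl⟩ _ ⟨u, hu, rfl⟩ h12 h23 h13
    rw [hpol] at h12 h23 h13
    have := congrArg φ (sum_inv_herm_eq_zero ht h12 h23 h13 (hne p hp) (hne u hu))
    rw [map_add, map_add, hodd p hp, hodd r hr, hodd u hu, map_zero] at this
    exact absurd this (by decide)
  obtain ⟨S, hS1, hS2, hS3⟩ := ρ.exists_triangleFree_figueroa hcomm h3 T hT1 hT3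
  have hcover : T ⊆ {x ∈ T | α.pt x = x} ∪ {x ∈ T | x ∈ α.pointsO3} ∪
      P '' (collinearPairs φ s t) := by
    rintro _ ⟨p, hp, rfl⟩
    by_cases h1 : α.pt (P p) = P p
    · exact Or.inl (Or.inl ⟨⟨p, hp, rfl⟩, h1⟩)
    by_cases h2 : P p ∈ α.pointsO3
    · exact Or.inl (Or.inr ⟨⟨p, hp, rfl⟩, h2⟩)
    refine Or.inr ⟨p, ?_, rfl⟩
    have h4 := collinear_equation hA hs (hA0 _ _)
      (α.exists_line_of_not_mem_pointsO3 h3 h1 h2)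
    rw [Finset.mem_coe, collinearPairs, Finset.mem_filter]
    refine ⟨hp, fun h5 => h1 ?_, h4⟩
    obtain ⟨n1, n2, h6⟩ := hs ![1, p.1, p.2] (by simp)
    have h7 : s ∘ ![1, p.1, p.2] = ![1, p.1, p.2] := by
      ext i; fin_cases i <;> simp [h5.1, h5.2]
    simp only [h7] at h6
    exact h6
  have hcard : (oddPairs φ t).card ≤ S.ncard + (collinearPairs φ s t).card := by
    have e1 : T.ncard = (oddPairs φ t).card := by
      rw [hT, Set.ncard_image_of_injective _ hPinj, Set.ncard_coe_finset]
    have e2 : (P '' (collinearPairs φ s t)).ncard = (collinearPairs φ s t).card := by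
      rw [Set.ncard_image_of_injective _ hPinj, Set.ncard_coe_finset]
    rw [← e1, ← e2, hS3]
    refine (Set.ncard_le_ncard hcover (Set.toFinite _)).trans ?_
    exact (Set.ncard_union_le _ _).trans (Nat.add_le_add_right (Set.ncard_union_le _ _) _)
  have hf : (elems (fixedField s)).card = q ^ 2 := by
    have := natCard_fixedField_pow s
    rw [hs3, hKn, show q ^ 6 = (q ^ 2) ^ 3 by ring] at this
    rw [card_elems]
    exact Nat.pow_left_injective (by norm_num : 3 ≠ 0) this
  have c1 := card_oddPairs hφ ht hb'
  have c2 := card_collinearPairs_le hφ ht hb hb' hf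
  rw [hK] at c1 c2
  obtain ⟨n, hn, hn'⟩ := exists_nat_bound hq hq1
  have hnS : n ≤ S.ncard := by omega
  obtain ⟨S', hS', hcS'⟩ := Set.exists_subset_card_eq hnS
  refine ⟨S', fun x hx => hS1 x (hS' hx), ?_, by rw [hcS', hn']⟩
  exact hS2.comap (SimpleGraph.induceHomOfLE _ hS').isContained

end Final

end FigueroaPlane

theorem mainTheorem4 (q : ℕ) (hq : Even q)
    {K : Type*} [Field K] [Fintype K] [DecidableEq K] (hK : Fintype.card K = q ^ 6)
    {k : Type*} [Field k] [Fintype k] (hk : Fintype.card k = q ^ 2)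
    (ρ : FigueroaPlane.Polarity (ℙ K (Fin 3 → K)) (ℙ K (Fin 3 → K))) (hρ : ρ.IsUnitary)
    (α : FigueroaPlane.Collineation (ℙ K (Fin 3 → K)) (ℙ K (Fin 3 → K)))
    (hα : orderOf α = 3)
    (hD : α.FixesSubplane (ℙ k (Fin 3 → k)) (ℙ k (Fin 3 → k)))
    (hcomm : ρ.CommutesWith α) :
    ∃ S : Set (ℙ K (Fin 3 → K)),
      (∀ x ∈ S, ¬ (ρ.figueroa α hcomm).IsAbsolute x) ∧
      ((ρ.figueroa α hcomm).graph.induce S).CliqueFree 3 ∧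
      (S.ncard : ℚ) =
        ((q : ℚ) ^ 12 - (q : ℚ) ^ 4 * ((q : ℚ) ^ 4 - 1) * ((q : ℚ) ^ 2 + 1)) / 2 :=
  FigueroaPlane.exists_triangleFree_set hq hK hρ hα hD hcomm
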